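/- Let $K\subset\mathbb{R}$ be a real-quadratic number field with ring of integers $\mathcal{O}_K$ and non-trivial automorphism $a\mapsto a'$, let $\Gamma_K=SL_2(\mathcal{O}_K)$, and write $M'$ for the matrix obtained from $M$ by applying $a\mapsto a'$ to all entries. For a non-degenerate symmetric even matrix $T\in\mathbb{Z}^{k\times k}$ let $SO(T;\mathbb{R})=\{U\in SL_k(\mathbb{R});\ U^{tr}TU=T\}$, let $SO_0(T;\mathbb{R})$ be its connected component of the identity matrix $I$, let $SO_0(T;\mathbb{Z})$ be the subgroup of integral matrices in it, and let $\mathcal{D}(T;\mathbb{Z})=\{U\in SO_0(T;\mathbb{Z});\ U\in I+\mathbb{Z}^{k\times k}T\}$ be the discriminant kernel. For $T\in\mathbb{Z}^{2\times2}$ and $N\in\mathbb{N}$, $N\ge1$, let $$T_N=\begin{pmatrix}0&0&N\\0&T&0\\N&0&0\end{pmatrix}\in\mathbb{Z}^{4\times4}.$$ Let $B=(u,v)$ be a $\mathbb{Z}$-basis of $\mathcal{O}_K$ and put $$P=\begin{pmatrix}0&1\\1&0\end{pmatrix},\quad G=\begin{pmatrix}u&v\\u'&v'\end{pmatrix},\quad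 \widehat G=\begin{pmatrix}1&0&0\\0&G&0\\0&0&1\end{pmatrix},\quad S=G^{tr}PG=\begin{pmatrix}2uu'&uv'+u'v\\uv'+u'v&2vv'\end{pmatrix}.$$ For $M=\begin{pmatrix}\alpha&\beta\\\gamma&\delta\end{pmatrix}\in\Gamma_K$ and $F=\mathrm{diag}(-1,1)$ let $$\Omega(M,M')=\begin{pmatrix}\alpha FM'F&\beta FM'\\\gamma M'F&\delta M'\end{pmatrix},\qquad \widetilde M=\widehat G^{-1}\,\Omega(M,M')\,\widehat G,$$ and let $\phi_B$ be the homomorphism $\pm M\mapsto\widetilde M$ on $\Gamma_K/\{\pm I\}$. Then for every $N\ge1$: (a) $\phi_B$ maps the congruence subgroup $$\left\{M=\begin{pmatrix}\alpha&\beta\\\gamma&\delta\end{pmatrix}\in\Gamma_K;\ \alpha\alpha'\equiv\delta\delta'\equiv1 \bmod N,\ \gamma\in N\mathcal{O}_K\right\}\Big/\{\pm I\}$$ onto $F_N\,\mathcal{D}(S_N;\mathbb{Z})\,F_N^{-1}$, where $F_N=\mathrm{diag}(1,1,1,N)$. (b) $\phi_B$ maps the principal congruence subgroup $$\{M\in\Gamma_K;\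 M\equiv\varepsilon I\bmod N\mathcal{O}_K \text{ for some } \varepsilon\in\mathbb{Z} \text{ with } \varepsilon^2\equiv1\bmod N\}/\{\pm I\}$$ onto $\mathcal{D}(N S_1;\mathbb{Z})$. -/

import Mathlib

open scoped NumberField MatrixGroups Matrix

namespace HilbertOrth

noncomputable section

/-! ### Orthogonal groups and discriminant kernels -/

section Orthogonal

variable {n : Type*} [Fintype n] [DecidableEq n]

/-- The special orthogonal group `SO(T; ℝ)`, as a set of real matrices. -/
def SO (T : Matrix n n ℝ) : Set (Matrix n n ℝ) :=
  {U | U.det = 1 ∧ Uᵀ * T * U = T}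

/-- `SO₀(T; ℝ)`: the connected component of the identity matrix in `SO(T; ℝ)`. -/
def SOZero (T : Matrix n n ℝ) : Set (Matrix n n ℝ) :=
  connectedComponentIn (SO T) 1

/-- The integral matrices, viewed as real matrices. -/
def integral (n : Type*) : Set (Matrix n n ℝ) :=
  {U | ∃ V : Matrix n n ℤ, U = V.map (fun z : ℤ => (z : ℝ))}

/-- `SO₀(T; ℤ)`: the integral matrices in `SO₀(T; ℝ)`. -/
def SOZeroInt (T : Matrix n n ℝ) : Set (Matrix n n ℝ) :=
  SOZero T ∩ integral n

/-- The discriminant kernel `𝓓(T; ℤ) = {U ∈ SO₀(T; ℤ) ; U ∈ I + ℤ^{m × m} T}`. -/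
def discKernel (T : Matrix n n ℝ) : Set (Matrix n n ℝ) :=
  {U | U ∈ SOZeroInt T ∧ ∃ X ∈ integral n, U = 1 + X * T}

end Orthogonal

/-- The orthogonal sum `T_N` of a `2 × 2` matrix `T` with the hyperbolic plane rescaled by `N`. -/
def hyp (T : Matrix (Fin 2) (Fin 2) ℝ) (N : ℕ) : Matrix (Fin 4) (Fin 4) ℝ :=
  !![0, 0, 0, (N : ℝ);
     0, T 0 0, T 0 1, 0;
     0, T 1 0, T 1 1, 0;
     (N : ℝ), 0, 0, 0]

/-- `F_N = diag(1, 1, 1, N)`. -/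
def FMat (N : ℕ) : Matrix (Fin 4) (Fin 4) ℝ :=
  Matrix.diagonal ![1, 1, 1, (N : ℝ)]

/-- `P`, the Gram matrix of the hyperbolic plane. -/
def PMat : Matrix (Fin 2) (Fin 2) ℝ := !![0, 1; 1, 0]

/-- `F = diag(-1, 1)`. -/
def signMat : Matrix (Fin 2) (Fin 2) ℝ := !![-1, 0; 0, 1]

/-- The `4 × 4` matrix made of four `2 × 2` blocks. -/
def blocks (A B C D : Matrix (Fin 2) (Fin 2) ℝ) : Matrix (Fin 4) (Fin 4) ℝ :=
  !![A 0 0, A 0 1, B 0 0, B 0 1;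
     A 1 0, A 1 1, B 1 0, B 1 1;
     C 0 0, C 0 1, D 0 0, D 0 1;
     C 1 0, C 1 1, D 1 0, D 1 1]

/-- `Ω(U, V)`, with blocks `α F V F`, `β F V`, `γ V F`, `δ V`, where `U = (α, β; γ, δ)`. -/
def Omega (U V : Matrix (Fin 2) (Fin 2) ℝ) : Matrix (Fin 4) (Fin 4) ℝ :=
  blocks (U 0 0 • (signMat * V * signMat)) (U 0 1 • (signMat * V))
    (U 1 0 • (V * signMat)) (U 1 1 • V)

/-- `diag(1, G, 1)`. -/
def hat (G : Matrix (Fin 2) (Fin 2) ℝ) : Matrix (Fin 4) (Fin 4) ℝ :=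
  !![1, 0, 0, 0;
     0, G 0 0, G 0 1, 0;
     0, G 1 0, G 1 1, 0;
     0, 0, 0, 1]

lemma Omega_apply (U V : Matrix (Fin 2) (Fin 2) ℝ) : Omega U V =
    !![U 0 0 * V 0 0, -(U 0 0 * V 0 1), -(U 0 1 * V 0 0), -(U 0 1 * V 0 1);
       -(U 0 0 * V 1 0), U 0 0 * V 1 1, U 0 1 * V 1 0, U 0 1 * V 1 1;
       -(U 1 0 * V 0 0), U 1 0 * V 0 1, U 1 1 * V 0 0, U 1 1 * V 0 1;
       -(U 1 0 * V 1 0), U 1 0 * V 1 1, U 1 1 * V 1 0, U 1 1 * V 1 1] := by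
  rw [Matrix.eta_fin_two V]
  ext i j
  fin_cases i <;> fin_cases j <;> simp [Omega, blocks, signMat]

lemma Omega_one : Omega 1 1 = 1 := by
  rw [Omega_apply]
  ext i j
  fin_cases i <;> fin_cases j <;> simp

lemma Omega_mul (U₁ V₁ U₂ V₂ : Matrix (Fin 2) (Fin 2) ℝ) :
    Omega (U₁ * U₂) (V₁ * V₂) = Omega U₁ V₁ * Omega U₂ V₂ := by
  simp only [Omega_apply]
  ext i j
  fin_cases i <;> fin_cases j <;>
    simp [Matrix.mul_apply, Fin.sum_univ_two, Fin.sum_univ_four] <;> ring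

lemma Omega_neg (U V : Matrix (Fin 2) (Fin 2) ℝ) : Omega (-U) (-V) = Omega U V := by
  simp only [Omega_apply, Matrix.neg_apply, neg_mul_neg]

lemma det_hat (G : Matrix (Fin 2) (Fin 2) ℝ) : (hat G).det = G.det := by
  simp [hat, Matrix.det_succ_row_zero, Fin.sum_univ_succ, Fin.succAbove]

/-! ### Real quadratic fields and the Hilbert modular group -/

section Quadratic

/- A real quadratic number field is a subfield `K` of `ℝ` of degree `2` over `ℚ`. -/
variable (K : IntermediateField ℚ ℝ) [Algebra.IsQuadraticExtension ℚ K]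

lemma card_aut : Nat.card (K ≃ₐ[ℚ] K) = 2 := by
  rw [IsGalois.card_aut_eq_finrank, Algebra.IsQuadraticExtension.finrank_eq_two]

lemma exists_conj : ∃ σ : K ≃ₐ[ℚ] K, σ ≠ 1 := by
  have : Nontrivial (K ≃ₐ[ℚ] K) := by
    have := card_aut K
    have hf : Finite (K ≃ₐ[ℚ] K) := Nat.finite_of_card_ne_zero (by omega)
    exact Finite.one_lt_card_iff_nontrivial.mp (by omega)
  exact exists_ne 1

/-- The non-trivial automorphism `a ↦ a'` of `K` (it is unique). -/
def conj : K ≃ₐ[ℚ] K := (exists_conj K).choose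

lemma conj_ne_one : conj K ≠ 1 := (exists_conj K).choose_spec

lemma eq_one_or_conj (τ : K ≃ₐ[ℚ] K) : τ = 1 ∨ τ = conj K := by
  obtain ⟨x, y, hxy, h⟩ := Nat.card_eq_two_iff.mp (card_aut K)
  have h' : ∀ z : K ≃ₐ[ℚ] K, z = x ∨ z = y := fun z => by
    have : z ∈ ({x, y} : Set _) := h ▸ Set.mem_univ z
    simpa using this
  have h0 := conj_ne_one K
  rcases h' τ with h1 | h1 <;> rcases h' 1 with h2 | h2 <;> rcases h' (conj K) with h3 | h3 <;>
    simp_all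

/-- The automorphism `a ↦ a'` restricted to the ring of integers. -/
def conjInt : 𝓞 K →+* 𝓞 K :=
  NumberField.RingOfIntegers.mapRingHom (conj K : K →+* K)

/-- The inclusion of the ring of integers in `ℝ`. -/
def emb : 𝓞 K →+* ℝ := (algebraMap K ℝ).comp (algebraMap (𝓞 K) K)

/-- The Hilbert modular group `Γ_K = SL₂(𝓞 K)`. -/
abbrev HilbertGroup : Type := SL(2, 𝓞 K)

/-- The subgroup `{±I}` of `Γ_K`. -/
def pmOne : Subgroup (HilbertGroup K) where
  carrier := {1, -1}
  one_mem' := by simp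
  mul_mem' := by rintro a b (rfl | rfl) (rfl | rfl) <;> simp
  inv_mem' := by rintro a (rfl | rfl) <;> simp

instance : (pmOne K).Normal where
  conj_mem := by rintro a (rfl | rfl) g <;> simp [pmOne]

/-- The matrix `M`, viewed in `ℝ^{2 × 2}`. -/
def realMat (M : HilbertGroup K) : Matrix (Fin 2) (Fin 2) ℝ :=
  (M : Matrix (Fin 2) (Fin 2) (𝓞 K)).map (emb K)

/-- The conjugate matrix `M'`, viewed in `ℝ^{2 × 2}`. -/
def realMatConj (M : HilbertGroup K) : Matrix (Fin 2) (Fin 2) ℝ :=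
  (M : Matrix (Fin 2) (Fin 2) (𝓞 K)).map (fun x => emb K (conjInt K x))

variable {K} in
/-- The base change matrix `G = (u, v; u', v')` of `B = (u, v)`. -/
def GMat (B : Module.Basis (Fin 2) ℤ (𝓞 K)) : Matrix (Fin 2) (Fin 2) ℝ :=
  !![emb K (B 0), emb K (B 1); emb K (conjInt K (B 0)), emb K (conjInt K (B 1))]

variable {K} in
/-- The Gram matrix `S = Gᵗ P G` of `B`. -/
def gram (B : Module.Basis (Fin 2) ℤ (𝓞 K)) : Matrix (Fin 2) (Fin 2) ℝ :=
  (GMat B)ᵀ * PMat * GMat B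

variable {K} in
lemma det_GMat_ne_zero (B : Module.Basis (Fin 2) ℤ (𝓞 K)) : (GMat B).det ≠ 0 := by
  intro h
  have h1 : B 0 * conjInt K (B 1) = B 1 * conjInt K (B 0) := by
    have hinj : Function.Injective (emb K) :=
      (algebraMap K ℝ).injective.comp NumberField.RingOfIntegers.coe_injective
    apply hinj
    simp only [GMat, Matrix.det_fin_two_of] at h
    rw [map_mul, map_mul]
    linarith
  have hv : ((B 1 : 𝓞 K) : K) ≠ 0 := by
    intro h0
    exact B.ne_zero 1 (NumberField.RingOfIntegers.coe_injective (by simpa using h0))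
  have hv' : conj K ((B 1 : 𝓞 K) : K) ≠ 0 := by simpa using hv
  have h2 : ((B 0 : 𝓞 K) : K) * conj K ((B 1 : 𝓞 K) : K)
      = ((B 1 : 𝓞 K) : K) * conj K ((B 0 : 𝓞 K) : K) := by
    have := congrArg (fun x : 𝓞 K => (x : K)) h1
    simpa [conjInt] using this
  have h3 : ((B 0 : 𝓞 K) : K) / ((B 1 : 𝓞 K) : K) ∈ (⊥ : IntermediateField ℚ K) := by
    rw [IsGalois.mem_bot_iff_fixed]
    intro τ
    rcases eq_one_or_conj K τ with rfl | rfl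
    · simp
    · rw [map_div₀, div_eq_div_iff hv' hv, mul_comm, ← h2]
  obtain ⟨q, hq⟩ := IntermediateField.mem_bot.mp h3
  have h4 : ((B 0 : 𝓞 K) : K) * (q.den : K) = (q.num : K) * ((B 1 : 𝓞 K) : K) := by
    rw [eq_div_iff hv] at hq
    rw [← hq]
    have h5 : (q.den : K) * (algebraMap ℚ K q) = (q.num : K) := by
      have := congrArg (algebraMap ℚ K) (Rat.den_mul_eq_num q)
      rwa [map_mul, map_natCast, map_intCast] at this
    rw [← h5]
    ring
  have h6 : (q.den : ℤ) • B 0 + (-q.num) • B 1 = 0 := by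
    apply NumberField.RingOfIntegers.coe_injective
    simp only [zsmul_eq_mul, map_add, map_mul, map_intCast, map_zero, Int.cast_neg, map_neg,
      Int.cast_natCast, map_natCast]
    rw [mul_comm, h4]
    ring
  have h7 := Fintype.linearIndependent_iff.mp B.linearIndependent ![(q.den : ℤ), -q.num]
    (by simpa [Fin.sum_univ_two] using h6) 0
  have h8 : (q.den : ℤ) = 0 := h7
  exact q.den_nz (by exact_mod_cast h8)

variable {K} in
/-- The homomorphism `M ↦ M̃ = Ĝ⁻¹ Ω(M, M') Ĝ` on `Γ_K`. -/
def tilde (B : Module.Basis (Fin 2) ℤ (𝓞 K)) : HilbertGroup K →* Matrix (Fin 4) (Fin 4) ℝ where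
  toFun M := (hat (GMat B))⁻¹ * Omega (realMat K M) (realMatConj K M) * hat (GMat B)
  map_one' := by
    have h : IsUnit (hat (GMat B)).det := by
      rw [det_hat]; exact (det_GMat_ne_zero B).isUnit
    have h1 : realMat K 1 = 1 := by simp [realMat]
    have h2 : realMatConj K 1 = 1 := by simp [realMatConj]
    rw [h1, h2, Omega_one, mul_one, Matrix.nonsing_inv_mul _ h]
  map_mul' M₁ M₂ := by
    have h : IsUnit (hat (GMat B)).det := by
      rw [det_hat]; exact (det_GMat_ne_zero B).isUnit
    have h1 : realMat K (M₁ * M₂) = realMat K M₁ * realMat K M₂ := by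
      simp [realMat, Matrix.map_mul]
    have h2 : realMatConj K (M₁ * M₂) = realMatConj K M₁ * realMatConj K M₂ := by
      ext i j
      simp [realMatConj, Matrix.mul_apply]
    rw [h1, h2, Omega_mul]
    simp only [mul_assoc]
    rw [← mul_assoc (hat (GMat B)) (hat (GMat B))⁻¹, Matrix.mul_nonsing_inv _ h, one_mul]

variable {K} in
/-- The homomorphism `φ_B` on `Γ_K / {±I}`, `±M ↦ M̃`. -/
def phi (B : Module.Basis (Fin 2) ℤ (𝓞 K)) :
    HilbertGroup K ⧸ pmOne K →* Matrix (Fin 4) (Fin 4) ℝ :=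
  QuotientGroup.lift (pmOne K) (tilde B) (by
    rintro M (rfl | rfl)
    · simp
    · rw [MonoidHom.mem_ker, ← map_one (tilde B)]
      have h1 : realMat K (-1) = -realMat K 1 := by ext i j; simp [realMat, -map_one]
      have h2 : realMatConj K (-1) = -realMatConj K 1 := by ext i j; simp [realMatConj, -map_one]
      simp only [tilde, MonoidHom.coe_mk, OneHom.coe_mk]
      rw [h1, h2, Omega_neg])

/-! ### Congruence subgroups -/

/-- The congruence subgroup of all `M = (α, β; γ, δ) ∈ Γ_K` with `αα' ≡ δδ' ≡ 1 mod N` and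
`γ ∈ N 𝓞 K`. -/
def gammaUpper (N : ℕ) : Subgroup (HilbertGroup K) where
  carrier := {M | (N : 𝓞 K) ∣ M 0 0 * conjInt K (M 0 0) - 1 ∧
    (N : 𝓞 K) ∣ M 1 1 * conjInt K (M 1 1) - 1 ∧ (N : 𝓞 K) ∣ M 1 0}
  one_mem' := by simp
  mul_mem' := by
    rintro A B ⟨⟨a, ha⟩, ⟨d, hd⟩, ⟨c, hc⟩⟩ ⟨⟨a', ha'⟩, ⟨d', hd'⟩, ⟨c', hc'⟩⟩
    rw [sub_eq_iff_eq_add] at ha hd ha' hd'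
    simp only [Set.mem_ofPred_eq, Matrix.SpecialLinearGroup.coe_mul, Matrix.mul_apply,
      Fin.sum_univ_two, map_add, map_mul, hc, hc', map_natCast]
    refine ⟨?_, ?_, ?_⟩
    · refine ⟨(A 0 0 * B 0 0) * (conjInt K (A 0 1) * conjInt K c') +
        (conjInt K (A 0 0) * conjInt K (B 0 0)) * (A 0 1 * c') +
        N * (A 0 1 * c' * (conjInt K (A 0 1) * conjInt K c')) + a * (N * a' + 1) + a', ?_⟩
      linear_combination (B 0 0 * conjInt K (B 0 0)) * ha + (N * a + 1) * ha'
    · refine ⟨(A 1 1 * B 1 1) * (conjInt K c * conjInt K (B 0 1)) +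
        (conjInt K (A 1 1) * conjInt K (B 1 1)) * (c * B 0 1) +
        N * (c * B 0 1 * (conjInt K c * conjInt K (B 0 1))) + d * (N * d' + 1) + d', ?_⟩
      linear_combination (B 1 1 * conjInt K (B 1 1)) * hd + (N * d + 1) * hd'
    · exact ⟨c * B 0 0 + A 1 1 * c', by ring⟩
  inv_mem' := by
    rintro A ⟨ha, hd, hc⟩
    simp only [Matrix.SpecialLinearGroup.SL2_inv_expl]
    exact ⟨by simpa using hd, by simpa using ha, by simpa using hc⟩

/-- The principal congruence subgroup of all `M ∈ Γ_K` with `M ≡ εI mod N 𝓞 K` for some `ε ∈ ℤ`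
with `ε² ≡ 1 mod N`. -/
def gammaPrincipal (N : ℕ) : Subgroup (HilbertGroup K) where
  carrier := {M | ∃ ε : ℤ, ε ^ 2 ≡ 1 [ZMOD N] ∧
    (N : 𝓞 K) ∣ M 0 0 - ε ∧ (N : 𝓞 K) ∣ M 0 1 ∧ (N : 𝓞 K) ∣ M 1 0 ∧ (N : 𝓞 K) ∣ M 1 1 - ε}
  one_mem' := ⟨1, by simp [Int.ModEq.refl], by simp⟩
  mul_mem' := by
    rintro A B ⟨e, he, ⟨a, ha⟩, ⟨b, hb⟩, ⟨c, hc⟩, ⟨d, hd⟩⟩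
      ⟨e', he', ⟨a', ha'⟩, ⟨b', hb'⟩, ⟨c', hc'⟩, ⟨d', hd'⟩⟩
    rw [sub_eq_iff_eq_add] at ha hd ha' hd'
    refine ⟨e * e', by simpa [mul_pow] using he.mul he', ?_⟩
    simp only [Matrix.SpecialLinearGroup.coe_mul, Matrix.mul_apply, Fin.sum_univ_two,
      ha, hb, hc, hd, ha', hb', hc', hd', Int.cast_mul]
    exact ⟨⟨N * a * a' + a * e' + e * a' + N * b * c', by ring⟩,
      ⟨N * a * b' + e * b' + N * b * d' + b * e', by ring⟩,
      ⟨N * c * a' + c * e' + N * d * c' + e * c', by ring⟩,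
      ⟨N * c * b' + N * d * d' + d * e' + e * d', by ring⟩⟩
  inv_mem' := by
    rintro A ⟨e, he, ha, hb, hc, hd⟩
    refine ⟨e, he, ?_⟩
    simp only [Matrix.SpecialLinearGroup.SL2_inv_expl]
    exact ⟨by simpa using hd, by simpa using hb, by simpa using hc, by simpa using ha⟩

/-- The image `Γ / {±I}` in `Γ_K / {±I}` of a subgroup `Γ` of `Γ_K`. -/
def modPM (H : Subgroup (HilbertGroup K)) : Subgroup (HilbertGroup K ⧸ pmOne K) :=
  H.map (QuotientGroup.mk' (pmOne K))

end Quadratic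

end

end HilbertOrth

namespace HilbertOrth

/-! ### The identity component of the orthogonal group -/

section Component

variable {n : Type*} [Fintype n] [DecidableEq n]

/-! The base change `Ĝ F_N` turns `S_N` into the fixed form `splitForm`, the sum of two hyperbolic
planes. There the connected group is explicit: `SO₀` is exactly `Ω(SL₂(ℝ) × SL₂(ℝ))`
(`mem_SOZero_splitForm_iff`), because `Ω(A, B)` is `A ⊗ B` up to signs. The discriminant kernel
becomes the condition that `Ω(A, B) - 1` lies in a lattice `L` times `splitForm`, where `L` is built
from `Ĝ ℤ^{4 × 4} Ĝᵗ` (`mem_discKernel_iff`). By `exists_latMat_iff`, `Ĝ ℤ^{4 × 4} Ĝᵗ` consists of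
matrices of integers and conjugate pairs from `𝓞 K`, subject to one congruence `m₁ ≡ m₂` modulo the
different `(ω - ω')`.

The main point is surjectivity: such a pair `(A, B)` must be `±(M, M')` with `M` in the Hilbert
modular group (`exists_hilbert_of_latMat`). Integrality and conjugacy of the products `A i j * B k
l` produce a scalar `μ` for which `μA` is integral over `𝓞 K` with conjugate `μB`; its determinant
`μ²` is a positive integer. By `prime_dvd_entries` every prime dividing this determinant divides all
entries, so the determinant descends to `1`. The congruence modulo the different is essential here:
it excludes determinants divisible by a ramified prime which does not divide the entries.

What remains is to match lattices with congruence conditions on `M`, which is done in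
`mem_gammaUpper_iff` and `mem_gammaPrincipal_iff`; both parts then follow from
`image_eq_discKernel`. -/

lemma one_mem_SO (T : Matrix n n ℝ) : (1 : Matrix n n ℝ) ∈ SO T := by
  simp [SO]

lemma mul_mem_SO {T U V : Matrix n n ℝ} (hU : U ∈ SO T) (hV : V ∈ SO T) : U * V ∈ SO T := by
  refine ⟨by rw [Matrix.det_mul, hU.1, hV.1, one_mul], ?_⟩
  calc (U * V)ᵀ * T * (U * V) = Vᵀ * (Uᵀ * T * U) * V := by
        rw [Matrix.transpose_mul]; simp only [mul_assoc]
    _ = T := by rw [hU.2, hV.2]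

lemma one_mem_SOZero (T : Matrix n n ℝ) : (1 : Matrix n n ℝ) ∈ SOZero T :=
  mem_connectedComponentIn (one_mem_SO T)

lemma SOZero_subset_SO (T : Matrix n n ℝ) : SOZero T ⊆ SO T :=
  connectedComponentIn_subset _ _

/-- Left translation by `U` carries the component of `1` to a connected set through `U`, and the
component of `U` is again that of `1`. -/
lemma mul_mem_SOZero {T U V : Matrix n n ℝ} (hU : U ∈ SOZero T) (hV : V ∈ SOZero T) :
    U * V ∈ SOZero T := by
  have hc : IsPreconnected ((fun W => U * W) '' SOZero T) :=
    isPreconnected_connectedComponentIn.image _ (by fun_prop)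
  have hs : (fun W => U * W) '' SOZero T ⊆ SO T := by
    rintro _ ⟨W, hW, rfl⟩
    exact mul_mem_SO (SOZero_subset_SO T hU) (SOZero_subset_SO T hW)
  have hm : U ∈ (fun W => U * W) '' SOZero T := ⟨1, one_mem_SOZero T, mul_one U⟩
  have := hc.subset_connectedComponentIn hm hs ⟨V, hV, rfl⟩
  rwa [← connectedComponentIn_eq hU] at this

lemma path_mem_SOZero {T : Matrix n n ℝ} (f : ℝ → Matrix n n ℝ) (hf : Continuous f)
    (h0 : f 0 = 1) (h : ∀ t, f t ∈ SO T) (t : ℝ) : f t ∈ SOZero T := by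
  have hc : IsPreconnected (Set.range f) := isPreconnected_range hf
  exact hc.subset_connectedComponentIn ⟨0, h0⟩ (by rintro _ ⟨s, rfl⟩; exact h s) ⟨t, rfl⟩

lemma conj_mem_SOZero {T U H : Matrix n n ℝ} (hH : IsUnit H.det) (hU : U ∈ SOZero T) :
    H⁻¹ * U * H ∈ SOZero (Hᵀ * T * H) := by
  have hc : IsPreconnected ((fun W => H⁻¹ * W * H) '' SOZero T) :=
    isPreconnected_connectedComponentIn.image _ (by fun_prop)
  have hs : (fun W => H⁻¹ * W * H) '' SOZero T ⊆ SO (Hᵀ * T * H) := by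
    rintro _ ⟨W, hW, rfl⟩
    have hW' := SOZero_subset_SO T hW
    refine ⟨by rw [Matrix.det_conj' ((Matrix.isUnit_iff_isUnit_det H).2 hH), hW'.1], ?_⟩
    have h1 : H * (H⁻¹ * W * H) = W * H := by
      rw [← mul_assoc, ← mul_assoc, Matrix.mul_nonsing_inv _ hH, one_mul]
    calc (H⁻¹ * W * H)ᵀ * (Hᵀ * T * H) * (H⁻¹ * W * H)
        = (H * (H⁻¹ * W * H))ᵀ * T * (H * (H⁻¹ * W * H)) := by
          rw [Matrix.transpose_mul H]; simp only [mul_assoc]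
      _ = Hᵀ * (Wᵀ * T * W) * H := by
          rw [h1, Matrix.transpose_mul]; simp only [mul_assoc]
      _ = Hᵀ * T * H := by rw [hW'.2]
  refine hc.subset_connectedComponentIn ⟨1, one_mem_SOZero T, ?_⟩ hs ⟨U, hU, rfl⟩
  simp [Matrix.nonsing_inv_mul _ hH]

lemma mem_SOZero_congr_iff {T V H : Matrix n n ℝ} (hH : IsUnit H.det) :
    V ∈ SOZero (Hᵀ * T * H) ↔ H * V * H⁻¹ ∈ SOZero T := by
  constructor
  · intro h
    have h' := conj_mem_SOZero (H := H⁻¹) (by simpa using hH) h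
    rw [Matrix.nonsing_inv_nonsing_inv _ hH] at h'
    convert h' using 2
    have h1 : H⁻¹ᵀ * Hᵀ = 1 := by
      rw [← Matrix.transpose_mul, Matrix.mul_nonsing_inv _ hH, Matrix.transpose_one]
    rw [mul_assoc, mul_assoc (Hᵀ * T), Matrix.mul_nonsing_inv _ hH, mul_one, ← mul_assoc, h1,
      one_mul]
  · intro h
    have h' := conj_mem_SOZero hH h
    convert h' using 1
    simp only [mul_assoc]
    rw [Matrix.nonsing_inv_mul _ hH, ← mul_assoc, Matrix.nonsing_inv_mul _ hH, one_mul, mul_one]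

lemma SOZero_smul {c : ℝ} (hc : c ≠ 0) (T : Matrix n n ℝ) : SOZero (c • T) = SOZero T := by
  have : SO (c • T) = SO T := by
    ext U
    simp only [SO, Set.mem_ofPred_eq, Matrix.mul_smul, Matrix.smul_mul]
    rw [smul_right_inj hc]
  rw [SOZero, this, SOZero]

end Component

/-! ### The split orthogonal group in dimension four -/

/-- The Gram matrix of the orthogonal sum of two hyperbolic planes. -/
def splitForm : Matrix (Fin 4) (Fin 4) ℝ := !![0, 0, 0, 1; 0, 0, 1, 0; 0, 1, 0, 0; 1, 0, 0, 0]

lemma det_Omega (A B : Matrix (Fin 2) (Fin 2) ℝ) :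
    (Omega A B).det = A.det ^ 2 * B.det ^ 2 := by
  rw [Omega_apply, Matrix.det_fin_two, Matrix.det_fin_two]
  simp [Matrix.det_succ_row_zero, Fin.sum_univ_succ, Fin.succAbove]
  ring

/-- Conjugating by `diag(-1, 1, 1, 1)` turns `Ω(A, B)` into the Kronecker product `A ⊗ B`, and
`-splitForm` into the tensor product of two copies of the alternating form on `ℝ²`; each factor is
scaled by a determinant. -/
lemma Omega_form (A B : Matrix (Fin 2) (Fin 2) ℝ) :
    (Omega A B)ᵀ * splitForm * Omega A B = (A.det * B.det) • splitForm := by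
  rw [Omega_apply, Matrix.det_fin_two, Matrix.det_fin_two, splitForm]
  ext i j
  fin_cases i <;> fin_cases j <;>
    simp [Matrix.mul_apply, Fin.sum_univ_four] <;> ring

lemma Omega_mem_SO {A B : Matrix (Fin 2) (Fin 2) ℝ} (h : A.det = B.det) (h1 : A.det ^ 2 = 1) :
    Omega A B ∈ SO splitForm := by
  refine ⟨by rw [det_Omega, ← h, h1, one_mul], ?_⟩
  rw [Omega_form, ← h, ← sq, h1, one_smul]

lemma continuous_Omega : Continuous fun p : Matrix (Fin 2) (Fin 2) ℝ × Matrix (Fin 2) (Fin 2) ℝ =>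
    Omega p.1 p.2 := by
  refine continuous_matrix fun i j => ?_
  simp only [Omega_apply]
  fin_cases i <;> fin_cases j <;> simp <;> fun_prop

/-- An induction principle for real matrices of determinant one: they are products of
elementary matrices. -/
lemma det_one_induction {p : Matrix (Fin 2) (Fin 2) ℝ → Prop}
    (hu : ∀ t : ℝ, p !![1, t; 0, 1]) (hl : ∀ t : ℝ, p !![1, 0; t, 1])
    (hm : ∀ A B, p A → p B → p (A * B)) {A : Matrix (Fin 2) (Fin 2) ℝ} (hA : A.det = 1) : p A := by
  have key : ∀ A : Matrix (Fin 2) (Fin 2) ℝ, A.det = 1 → A 1 0 ≠ 0 → p A := by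
    intro A hA hc
    rw [Matrix.det_fin_two] at hA
    -- Big Bruhat cell: upper, lower, upper unipotent.
    have : A = !![1, (A 0 0 - 1) / A 1 0; 0, 1] * !![1, 0; A 1 0, 1] *
        !![1, (A 1 1 - 1) / A 1 0; 0, 1] := by
      ext i j
      fin_cases i <;> fin_cases j <;> simp [Matrix.mul_apply, Fin.sum_univ_two] <;> field_simp
      · ring
      · linear_combination -hA
      · ring
    rw [this]
    exact hm _ _ (hm _ _ (hu _) (hl _)) (hu _)
  by_cases hc : A 1 0 = 0
  · have h0 : A 0 0 ≠ 0 := by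
      intro h
      simp [Matrix.det_fin_two, h, hc] at hA
    -- Adding the first row to the second makes the lower left entry `A 0 0 ≠ 0`, which leads back
    -- to the big cell.
    have h1 : A = !![1, 0; -1, 1] * (!![1, 0; 1, 1] * A) := by
      have h2 : (!![1, 0; -1, 1] : Matrix (Fin 2) (Fin 2) ℝ) * !![1, 0; 1, 1] = 1 := by
        simp [Matrix.one_fin_two]
      rw [← mul_assoc, h2, one_mul]
    rw [h1]
    refine hm _ _ (hl _) (key _ ?_ ?_)
    · rw [Matrix.det_mul, hA, Matrix.det_fin_two]; simp
    · simpa [Matrix.mul_apply, Fin.sum_univ_two, hc] using h0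
  · exact key A hA hc

/-- Each elementary matrix lies on a one-parameter group through the identity, so `Ω` gives a path
in `SO`; the two arguments are treated separately because `Ω(A, B) = Ω(A, 1) Ω(1, B)`. -/
lemma Omega_mem_SOZero {A B : Matrix (Fin 2) (Fin 2) ℝ} (hA : A.det = 1) (hB : B.det = 1) :
    Omega A B ∈ SOZero splitForm := by
  have hcu : Continuous fun t : ℝ => (!![1, t; 0, 1] : Matrix (Fin 2) (Fin 2) ℝ) := by fun_prop
  have hcl : Continuous fun t : ℝ => (!![1, 0; t, 1] : Matrix (Fin 2) (Fin 2) ℝ) := by fun_prop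
  have h1u : (!![1, 0; 0, 1] : Matrix (Fin 2) (Fin 2) ℝ) = 1 := Matrix.one_fin_two.symm
  have hl : Omega A 1 ∈ SOZero splitForm := by
    refine det_one_induction (p := fun A => Omega A 1 ∈ SOZero splitForm) ?_ ?_ ?_ hA
    · exact path_mem_SOZero (fun t => Omega !![1, t; 0, 1] 1)
        (continuous_Omega.comp (hcu.prodMk continuous_const)) (by rw [h1u, Omega_one])
        fun t => Omega_mem_SO (by simp [Matrix.det_fin_two]) (by simp [Matrix.det_fin_two])
    · exact path_mem_SOZero (fun t => Omega !![1, 0; t, 1] 1)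
        (continuous_Omega.comp (hcl.prodMk continuous_const)) (by rw [h1u, Omega_one])
        fun t => Omega_mem_SO (by simp [Matrix.det_fin_two]) (by simp [Matrix.det_fin_two])
    · intro A B hA hB
      rw [← one_mul (1 : Matrix (Fin 2) (Fin 2) ℝ), Omega_mul]
      exact mul_mem_SOZero hA hB
  have hr : Omega 1 B ∈ SOZero splitForm := by
    refine det_one_induction (p := fun B => Omega 1 B ∈ SOZero splitForm) ?_ ?_ ?_ hB
    · exact path_mem_SOZero (fun t => Omega 1 !![1, t; 0, 1])
        (continuous_Omega.comp (continuous_const.prodMk hcu)) (by rw [h1u, Omega_one])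
        fun t => Omega_mem_SO (by simp [Matrix.det_fin_two]) (by simp)
    · exact path_mem_SOZero (fun t => Omega 1 !![1, 0; t, 1])
        (continuous_Omega.comp (continuous_const.prodMk hcl)) (by rw [h1u, Omega_one])
        fun t => Omega_mem_SO (by simp [Matrix.det_fin_two]) (by simp)
    · intro A B hA hB
      rw [← one_mul (1 : Matrix (Fin 2) (Fin 2) ℝ), Omega_mul]
      exact mul_mem_SOZero hA hB
  have := mul_mem_SOZero hl hr
  rwa [← Omega_mul, one_mul, mul_one] at this

/-- A non-zero vector of `ℝ²` is the first column of a matrix of determinant one. -/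
lemma exists_det_one_col {a b : ℝ} (h : a ≠ 0 ∨ b ≠ 0) :
    ∃ A : Matrix (Fin 2) (Fin 2) ℝ, A.det = 1 ∧ A 0 0 = a ∧ A 1 0 = b := by
  have h2 : a ^ 2 + b ^ 2 ≠ 0 := by
    rcases h with h | h <;> positivity
  refine ⟨!![a, -b / (a ^ 2 + b ^ 2); b, a / (a ^ 2 + b ^ 2)], ?_, rfl, rfl⟩
  rw [Matrix.det_fin_two_of]
  field_simp
  ring

/-- A singular non-zero `2 × 2` matrix is a product of a column and a row. -/
lemma exists_rank_one {x y z w : ℝ} (h : x * w = y * z) (hne : ¬(x = 0 ∧ y = 0 ∧ z = 0 ∧ w = 0)) :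
    ∃ a b c d : ℝ, (a ≠ 0 ∨ b ≠ 0) ∧ (c ≠ 0 ∨ d ≠ 0) ∧
      x = a * c ∧ y = a * d ∧ z = b * c ∧ w = b * d := by
  by_cases hx : x = 0
  · by_cases hy : y = 0
    · refine ⟨0, 1, z, w, by simp, ?_, by simp [hx], by simp [hy], by simp, by simp⟩
      by_contra! hc
      exact hne ⟨hx, hy, hc⟩
    · refine ⟨1, w / y, x, y, by simp, .inr hy, by simp, by simp, ?_, ?_⟩ <;> field_simp
      linarith
  · refine ⟨1, z / x, x, y, by simp, .inl hx, by simp, by simp, ?_, ?_⟩ <;> field_simp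
    linarith

lemma Omega_mul_adjugate {A B : Matrix (Fin 2) (Fin 2) ℝ} (hA : A.det = 1) (hB : B.det = 1) :
    Omega A B * Omega A.adjugate B.adjugate = 1 := by
  rw [← Omega_mul, Matrix.mul_adjugate, Matrix.mul_adjugate, hA, hB, one_smul, Omega_one]

lemma splitForm_apply_eq_of_mem_SO {U : Matrix (Fin 4) (Fin 4) ℝ} (h : U ∈ SO splitForm)
    (i j : Fin 4) : U 0 i * U 3 j + U 1 i * U 2 j + U 2 i * U 1 j + U 3 i * U 0 j =
      splitForm i j := by
  rw [← h.2, splitForm]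
  simp [Matrix.mul_apply, Fin.sum_univ_four]
  ring

/-- Isotropic vectors are the pure tensors in `ℝ² ⊗ ℝ²`, so translation by some `Ω(A, B)` makes `U`
fix the first basis vector. A unipotent translation then makes it fix the last one too, and what is
left is an isometry of determinant one of the middle hyperbolic plane. -/
lemma exists_Omega_of_mem_SO {U : Matrix (Fin 4) (Fin 4) ℝ} (hU : U ∈ SO splitForm) :
    ∃ A B : Matrix (Fin 2) (Fin 2) ℝ, A.det = B.det ∧ A.det ^ 2 = 1 ∧ U = Omega A B := by
  -- it suffices to treat a translate of `U`
  have red : ∀ (V : Matrix (Fin 4) (Fin 4) ℝ) (A B : Matrix (Fin 2) (Fin 2) ℝ), A.det = 1 →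
      B.det = 1 → (∃ A' B' : Matrix (Fin 2) (Fin 2) ℝ, A'.det = B'.det ∧ A'.det ^ 2 = 1 ∧
        Omega A.adjugate B.adjugate * V = Omega A' B') →
      ∃ A' B' : Matrix (Fin 2) (Fin 2) ℝ, A'.det = B'.det ∧ A'.det ^ 2 = 1 ∧ V = Omega A' B' := by
    rintro V A B hA hB ⟨A', B', h1, h2, h3⟩
    refine ⟨A * A', B * B', by simp [hA, hB, h1], by simp [hA, h2], ?_⟩
    rw [Omega_mul, ← h3, ← mul_assoc, Omega_mul_adjugate hA hB, one_mul]
  have hmem : ∀ {V : Matrix (Fin 4) (Fin 4) ℝ} {A B : Matrix (Fin 2) (Fin 2) ℝ}, V ∈ SO splitForm →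
      A.det = 1 → B.det = 1 → Omega A.adjugate B.adjugate * V ∈ SO splitForm := by
    intro V A B hV hA hB
    exact mul_mem_SO (Omega_mem_SO (by simp [Matrix.det_adjugate, hA, hB])
      (by simp [Matrix.det_adjugate, hA])) hV
  -- the image of the first basis vector is isotropic
  obtain ⟨a, b, c, d, hab, hcd, h0, h1, h2, h3⟩ :
      ∃ a b c d : ℝ, (a ≠ 0 ∨ b ≠ 0) ∧ (c ≠ 0 ∨ d ≠ 0) ∧
      U 0 0 = a * c ∧ -U 1 0 = a * d ∧ -U 2 0 = b * c ∧ -U 3 0 = b * d := by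
    refine exists_rank_one ?_ ?_
    · have := splitForm_apply_eq_of_mem_SO hU 0 0
      simp [splitForm] at this
      linarith
    · rintro ⟨h0, h1, h2, h3⟩
      rw [neg_eq_zero] at h1 h2 h3
      have := splitForm_apply_eq_of_mem_SO hU 0 3
      simp [splitForm, h0, h1, h2, h3] at this
  obtain ⟨A, hA, hA0, hA1⟩ := exists_det_one_col hab
  obtain ⟨B, hB, hB0, hB1⟩ := exists_det_one_col hcd
  refine red U A B hA hB ?_
  have hV := hmem hU hA hB
  have hV0 : ∀ i, (Omega A.adjugate B.adjugate * U) i 0 = (1 : Matrix (Fin 4) (Fin 4) ℝ) i 0 := by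
    intro i
    have hc : ∀ i, U i 0 = Omega A B i 0 := by
      intro i
      fin_cases i <;> simp [Omega_apply, hA0, hA1, hB0, hB1] <;> linarith
    have : (Omega A.adjugate B.adjugate * U) i 0
        = (Omega A.adjugate B.adjugate * Omega A B) i 0 := by
      simp only [Matrix.mul_apply, hc]
    rw [this, ← Omega_mul, Matrix.adjugate_mul, Matrix.adjugate_mul, hA, hB, one_smul, Omega_one]
  generalize Omega A.adjugate B.adjugate * U = V at hV hV0
  clear hU h0 h1 h2 h3 hA hB hA0 hA1 hB0 hB1
  have v00 : V 0 0 = 1 := by simpa using hV0 0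
  have v10 : V 1 0 = 0 := by simpa using hV0 1
  have v20 : V 2 0 = 0 := by simpa using hV0 2
  have v30 : V 3 0 = 0 := by simpa using hV0 3
  -- The first basis vector is fixed and pairs to `1` with the last one.
  have v33 : V 3 3 = 1 := by
    simpa [v00, v10, v20, v30, splitForm] using splitForm_apply_eq_of_mem_SO hV 0 3
  have q33 := splitForm_apply_eq_of_mem_SO hV 3 3
  simp [splitForm, v33] at q33
  -- The last column of `Ω` of these two unipotents is `(-V 1 3 * V 2 3, V 1 3, V 2 3, 1)`; isotropy
  -- (`q33`) shows that this is the last column of `V`.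
  have d1 : (!![1, V 1 3; 0, 1] : Matrix (Fin 2) (Fin 2) ℝ).det = 1 := by
    simp [Matrix.det_fin_two]
  have d2 : (!![1, V 2 3; 0, 1] : Matrix (Fin 2) (Fin 2) ℝ).det = 1 := by
    simp [Matrix.det_fin_two]
  refine red V _ _ d1 d2 ?_
  have hW := hmem hV d1 d2
  have hW0 : ∀ i, (Omega (!![1, V 1 3; 0, 1] : Matrix (Fin 2) (Fin 2) ℝ).adjugate
      (!![1, V 2 3; 0, 1] : Matrix (Fin 2) (Fin 2) ℝ).adjugate * V) i 0
      = (1 : Matrix (Fin 4) (Fin 4) ℝ) i 0 := by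
    intro i
    fin_cases i <;> simp [Omega_apply, Matrix.mul_apply, Fin.sum_univ_four, Matrix.adjugate_fin_two,
      v00, v10, v20, v30]
    rfl
  have hW3 : ∀ i, (Omega (!![1, V 1 3; 0, 1] : Matrix (Fin 2) (Fin 2) ℝ).adjugate
      (!![1, V 2 3; 0, 1] : Matrix (Fin 2) (Fin 2) ℝ).adjugate * V) i 3
      = (1 : Matrix (Fin 4) (Fin 4) ℝ) i 3 := by
    intro i
    fin_cases i <;> simp [Omega_apply, Matrix.mul_apply, Fin.sum_univ_four, Matrix.adjugate_fin_two,
      v33]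
    · linarith
    · rfl
  generalize Omega (!![1, V 1 3; 0, 1] : Matrix (Fin 2) (Fin 2) ℝ).adjugate
      (!![1, V 2 3; 0, 1] : Matrix (Fin 2) (Fin 2) ℝ).adjugate * V = W at hW hW0 hW3
  clear red hmem hV hV0 v00 v10 v20 v30 v33 q33 d1 d2
  have w00 : W 0 0 = 1 := by simpa using hW0 0
  have w10 : W 1 0 = 0 := by simpa using hW0 1
  have w20 : W 2 0 = 0 := by simpa using hW0 2
  have w30 : W 3 0 = 0 := by simpa using hW0 3
  have w03 : W 0 3 = 0 := by simpa using hW3 0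
  have w13 : W 1 3 = 0 := by simpa using hW3 1
  have w23 : W 2 3 = 0 := by simpa using hW3 2
  have w33 : W 3 3 = 1 := by simpa using hW3 3
  have w31 : W 3 1 = 0 := by
    simpa [w00, w10, w20, w30, splitForm] using splitForm_apply_eq_of_mem_SO hW 0 1
  have w32 : W 3 2 = 0 := by
    simpa [w00, w10, w20, w30, splitForm] using splitForm_apply_eq_of_mem_SO hW 0 2
  have w01 : W 0 1 = 0 := by
    simpa [w03, w13, w23, w33, splitForm] using splitForm_apply_eq_of_mem_SO hW 3 1
  have w02 : W 0 2 = 0 := by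
    simpa [w03, w13, w23, w33, splitForm] using splitForm_apply_eq_of_mem_SO hW 3 2
  have e11 := splitForm_apply_eq_of_mem_SO hW 1 1
  have e22 := splitForm_apply_eq_of_mem_SO hW 2 2
  have e12 := splitForm_apply_eq_of_mem_SO hW 1 2
  simp [splitForm, w01, w02, w31, w32] at e11 e22 e12
  have hd := hW.1
  simp [Matrix.det_succ_row_zero, Fin.sum_univ_succ, Fin.succAbove, w00, w10, w20,
    w30, w13, w23, w33, w31, w32] at hd
  -- The determinant gives `W 1 1 * W 2 2 - W 1 2 * W 2 1 = 1` and the form gives the same with a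
  -- plus sign; add them.
  have hps : W 1 1 * W 2 2 = 1 := by linarith
  have hp : W 1 1 ≠ 0 := left_ne_zero_of_mul_eq_one hps
  have hs : W 2 2 ≠ 0 := right_ne_zero_of_mul_eq_one hps
  have w21 : W 2 1 = 0 := by
    have : W 1 1 * W 2 1 = 0 := by linarith
    exact (mul_eq_zero.mp this).resolve_left hp
  have w12 : W 1 2 = 0 := by
    have : W 2 2 * W 1 2 = 0 := by linarith
    exact (mul_eq_zero.mp this).resolve_left hs
  have hs' : W 2 2 = (W 1 1)⁻¹ := eq_inv_of_mul_eq_one_right hps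
  -- The sign `σ` of `W 1 1` becomes the common determinant of the two factors; for `σ = -1` the
  -- matrix lies outside the identity component.
  obtain ⟨r, hr, σ, hσ, hrσ⟩ : ∃ r : ℝ, r ≠ 0 ∧ ∃ σ : ℝ, σ ^ 2 = 1 ∧ W 1 1 = σ * r ^ 2 := by
    rcases lt_or_gt_of_ne hp with h | h
    · exact ⟨√(-W 1 1), by rw [Real.sqrt_ne_zero']; linarith, -1, by norm_num,
        by rw [Real.sq_sqrt (by linarith)]; ring⟩
    · exact ⟨√(W 1 1), by rw [Real.sqrt_ne_zero']; linarith, 1, by norm_num,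
        by rw [Real.sq_sqrt h.le]; ring⟩
  have hσ0 : σ ≠ 0 := by rintro rfl; norm_num at hσ
  have hσ' : σ⁻¹ = σ := inv_eq_of_mul_eq_one_left (by rw [← sq, hσ])
  refine ⟨!![r, 0; 0, σ * r⁻¹], !![r⁻¹, 0; 0, σ * r], ?_, ?_, ?_⟩
  · simp only [Matrix.det_fin_two_of]; field_simp
  · simp only [Matrix.det_fin_two_of]; field_simp; linear_combination hσ
  · rw [Omega_apply]
    ext i j
    fin_cases i <;> fin_cases j <;>
      simp [w00, w01, w02, w03, w10, w20, w30, w13, w23, w33, w31, w32, w12, w21, hs', hrσ, hσ', hr]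
    · ring
    · ring
    · field_simp; linarith

lemma mem_SOZero_splitForm_iff {U : Matrix (Fin 4) (Fin 4) ℝ} :
    U ∈ SOZero splitForm ↔
      ∃ A B : Matrix (Fin 2) (Fin 2) ℝ, A.det = 1 ∧ B.det = 1 ∧ U = Omega A B := by
  constructor
  · intro hU
    -- Signed sum of the determinants of the four `2 × 2` blocks. On `Ω(A, B)` it equals `det B`
    -- times the sum of squares of the entries of `A`, so it never vanishes on `SO` and its sign
    -- separates `det = 1` from `det = -1`.
    let f : Matrix (Fin 4) (Fin 4) ℝ → ℝ := fun U =>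
      (U 0 0 * U 1 1 - U 0 1 * U 1 0) + (U 0 3 * U 1 2 - U 0 2 * U 1 3)
        + (U 2 1 * U 3 0 - U 2 0 * U 3 1) + (U 2 2 * U 3 3 - U 2 3 * U 3 2)
    have hf : ∀ A B : Matrix (Fin 2) (Fin 2) ℝ,
        f (Omega A B) = B.det * (A 0 0 ^ 2 + A 0 1 ^ 2 + A 1 0 ^ 2 + A 1 1 ^ 2) := by
      intro A B
      simp only [f, Omega_apply, Matrix.det_fin_two]
      simp
      ring
    have hne : ∀ V ∈ SO splitForm, f V ≠ 0 := by
      intro V hV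
      obtain ⟨A, B, h1, h2, rfl⟩ := exists_Omega_of_mem_SO hV
      rw [hf, ← h1]
      have hA : A.det ≠ 0 := by intro h; simp [h] at h2
      refine mul_ne_zero hA fun h => hA ?_
      have h00 : A 0 0 = 0 := by nlinarith [sq_nonneg (A 0 1), sq_nonneg (A 1 0), sq_nonneg (A 1 1)]
      have h01 : A 0 1 = 0 := by nlinarith [sq_nonneg (A 0 0), sq_nonneg (A 1 0), sq_nonneg (A 1 1)]
      rw [Matrix.det_fin_two, h00, h01]
      ring
    have hpos : 0 < f U := by
      by_contra! hle
      have h1 : 0 ≤ f 1 := by simp [f]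
      obtain ⟨V, hV, hV0⟩ := (isPreconnected_connectedComponentIn :
        IsPreconnected (SOZero splitForm)).intermediate_value hU (one_mem_SOZero _)
        (by fun_prop : Continuous f).continuousOn ⟨hle, h1⟩
      exact hne V (SOZero_subset_SO _ hV) hV0
    obtain ⟨A, B, h1, h2, rfl⟩ := exists_Omega_of_mem_SO (SOZero_subset_SO _ hU)
    rw [hf] at hpos
    have hB : 0 < B.det := pos_of_mul_pos_left hpos (by positivity)
    have hA1 : A.det = 1 := by
      rw [← h1] at hB
      nlinarith
    exact ⟨A, B, hA1, h1 ▸ hA1, rfl⟩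
  · rintro ⟨A, B, hA, hB, rfl⟩
    exact Omega_mem_SOZero hA hB

/-! ### Arithmetic of the ring of integers -/

section Arithmetic

lemma emb_injective (K : IntermediateField ℚ ℝ) : Function.Injective (emb K) :=
  (algebraMap K ℝ).injective.comp NumberField.RingOfIntegers.coe_injective

variable (K : IntermediateField ℚ ℝ) [Algebra.IsQuadraticExtension ℚ K]

lemma conj_conj (x : K) : conj K (conj K x) = x := by
  rcases eq_one_or_conj K (conj K * conj K) with h | h
  · exact DFunLike.congr_fun h x
  · exact absurd (mul_eq_left.mp h) (conj_ne_one K)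

lemma conjInt_conjInt (x : 𝓞 K) : conjInt K (conjInt K x) = x := by
  apply NumberField.RingOfIntegers.coe_injective
  exact conj_conj K x

variable {K}

/-- `ω` generates the ring of integers as a ring, that is, `(1, ω)` is an integral basis. -/
def IsGen (ω : 𝓞 K) : Prop :=
  ω - conjInt K ω ≠ 0 ∧ ∀ x : 𝓞 K, ∃ a b : ℤ, x = a + b * ω

/-- The coordinates `m`, `n` of `1` are coprime, since their gcd divides `1` in `𝓞 K`; a Bézout
relation completes `1` to a basis. If `ω` were fixed by conjugation, so would be `B`, and `det G`
would vanish. -/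
lemma exists_isGen (B : Module.Basis (Fin 2) ℤ (𝓞 K)) : ∃ ω : 𝓞 K, IsGen ω := by
  have hB : ∀ x : 𝓞 K, x = (B.repr x 0 : 𝓞 K) * B 0 + (B.repr x 1 : 𝓞 K) * B 1 := by
    intro x
    conv_lhs => rw [← B.sum_repr x]
    simp [Fin.sum_univ_two]
  set m := B.repr 1 0 with hm
  set n := B.repr 1 1 with hn
  have h1 : (1 : 𝓞 K) = m * B 0 + n * B 1 := hB 1
  have hcop : IsCoprime m n := by
    rw [Int.isCoprime_iff_gcd_eq_one]
    obtain ⟨c, hc⟩ := Int.gcd_dvd_left m n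
    obtain ⟨d, hd⟩ := Int.gcd_dvd_right m n
    have hu : IsUnit (algebraMap ℤ (𝓞 K) (Int.gcd m n : ℤ)) := by
      refine IsUnit.of_mul_eq_one (c * B 0 + d * B 1) ?_
      have hc' : (m : 𝓞 K) = (Int.gcd m n : ℤ) * c := by exact_mod_cast congrArg (Int.cast : ℤ → 𝓞 K) hc
      have hd' : (n : 𝓞 K) = (Int.gcd m n : ℤ) * d := by exact_mod_cast congrArg (Int.cast : ℤ → 𝓞 K) hd
      simp only [algebraMap_int_eq, eq_intCast]
      linear_combination -h1 - B 0 * hc' - B 1 * hd'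
    have := isUnit_of_map_unit (algebraMap ℤ (𝓞 K)) _ hu
    simpa [Int.isUnit_iff_natAbs_eq] using this
  obtain ⟨a, b, hab⟩ := hcop
  have hab' : (a : 𝓞 K) * m + b * n = 1 := by exact_mod_cast congrArg (Int.cast : ℤ → 𝓞 K) hab
  have h0 : B 0 = a - n * (-b * B 0 + a * B 1) := by
    linear_combination (-B 0) * hab' - (a : 𝓞 K) * h1
  have h1' : B 1 = b + m * (-b * B 0 + a * B 1) := by
    linear_combination (-B 1) * hab' - (b : 𝓞 K) * h1
  refine ⟨-b * B 0 + a * B 1, ?_, ?_⟩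
  · intro h
    rw [sub_eq_zero] at h
    have e0 : conjInt K (B 0) = B 0 := by
      conv_lhs => rw [h0]
      rw [map_sub, map_mul, ← h, map_intCast, map_intCast]
      exact h0.symm
    have e1 : conjInt K (B 1) = B 1 := by
      conv_lhs => rw [h1']
      rw [map_add, map_mul, ← h, map_intCast, map_intCast]
      exact h1'.symm
    apply det_GMat_ne_zero B
    rw [GMat, e0, e1, Matrix.det_fin_two_of]
    ring
  · intro x
    refine ⟨B.repr x 0 * a + B.repr x 1 * b, -B.repr x 0 * n + B.repr x 1 * m, ?_⟩
    conv_lhs => rw [hB x]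
    push_cast
    linear_combination (B.repr x 0 : 𝓞 K) * h0 + (B.repr x 1 : 𝓞 K) * h1'

namespace IsGen

variable {ω : 𝓞 K}

lemma eq_of_eq (h : IsGen ω) {a b c d : ℤ} (he : (a : 𝓞 K) + b * ω = c + d * ω) : a = c ∧ b = d := by
  have he' := congrArg (conjInt K) he
  simp only [map_add, map_mul, map_intCast] at he'
  have h1 : ((b : 𝓞 K) - d) * (ω - conjInt K ω) = 0 := by linear_combination he - he'
  have h2 : (b : 𝓞 K) = d := sub_eq_zero.1 ((mul_eq_zero.1 h1).resolve_right h.1)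
  rw [h2, add_left_inj] at he
  exact ⟨by exact_mod_cast he, by exact_mod_cast h2⟩

lemma dvd_iff (h : IsGen ω) {p a b : ℤ} : (p : 𝓞 K) ∣ a + b * ω ↔ p ∣ a ∧ p ∣ b := by
  constructor
  · rintro ⟨x, hx⟩
    obtain ⟨c, d, rfl⟩ := h.2 x
    obtain ⟨h1, h2⟩ := h.eq_of_eq (a := a) (b := b) (c := p * c) (d := p * d)
      (by push_cast; linear_combination hx)
    exact ⟨⟨c, h1⟩, ⟨d, h2⟩⟩
  · rintro ⟨⟨c, rfl⟩, ⟨d, rfl⟩⟩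
    exact ⟨c + d * ω, by push_cast; ring⟩

lemma intCast_dvd_iff (h : IsGen ω) {p a : ℤ} : (p : 𝓞 K) ∣ a ↔ p ∣ a := by
  simpa using h.dvd_iff (p := p) (a := a) (b := 0)

lemma exists_int_of_conj_eq (h : IsGen ω) {x : 𝓞 K} (hx : conjInt K x = x) : ∃ n : ℤ, x = n := by
  obtain ⟨a, b, rfl⟩ := h.2 x
  simp only [map_add, map_mul, map_intCast] at hx
  have h1 : (b : 𝓞 K) * (ω - conjInt K ω) = 0 := by linear_combination -hx
  exact ⟨a, by rw [(mul_eq_zero.1 h1).resolve_right h.1]; ring⟩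

lemma dvd_sub_conj (h : IsGen ω) (x : 𝓞 K) : ω - conjInt K ω ∣ x - conjInt K x := by
  obtain ⟨a, b, rfl⟩ := h.2 x
  exact ⟨b, by simp only [map_add, map_mul, map_intCast]; ring⟩

/-- If all products of two entries of `α` are divisible by `det α`, and a certain
congruence modulo the different holds, then `α` is divisible by every prime dividing `det α`. -/
lemma prime_dvd_entries (h : IsGen ω) {p k : ℤ} (hp : Prime p) (hk : p ∣ k)
    (α : Matrix (Fin 2) (Fin 2) (𝓞 K)) (hdet : α.det = k)
    (hsq : ∀ i j i' j', (k : 𝓞 K) ∣ α i j * α i' j')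
    (hdiff : (k : 𝓞 K) * (ω - conjInt K ω) ∣
      α 0 0 * (α 1 1 - conjInt K (α 1 1)) - α 0 1 * (α 1 0 - conjInt K (α 1 0))) (i j : Fin 2) :
    (p : 𝓞 K) ∣ α i j := by
  have : FiniteDimensional ℚ K := Module.finite_of_finrank_pos
    (by rw [Algebra.IsQuadraticExtension.finrank_eq_two]; norm_num)
  have : NumberField K := {}
  by_contra hij
  have hkO : (p : 𝓞 K) ∣ k := h.intCast_dvd_iff.2 hk
  have hp0 : (p : 𝓞 K) ≠ 0 := by exact_mod_cast hp.ne_zero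
  -- Otherwise `p²` divides `(α i j)²`, and integral closedness gives `p ∣ α i j`. The contradiction
  -- at the end is that `p² ∣ k` after all.
  have hk2 : ¬p ^ 2 ∣ k := by
    intro hp2
    have h2 : (p : 𝓞 K) ^ 2 ∣ k := by exact_mod_cast h.intCast_dvd_iff.2 hp2
    apply hij
    rw [← IsIntegrallyClosed.pow_dvd_pow_iff two_ne_zero, sq (α i j)]
    exact h2.trans (hsq i j i j)
  -- An element that is a rational integer modulo `p` and squares to zero modulo `p` is zero modulo
  -- `p`. Hence the nilpotent entry `α i j` has an `ω`-coordinate prime to `p`, and subtracting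
  -- multiples of it removes the `ω`-coordinate of the other entries.
  have hint : ∀ z : ℤ, ∀ b : ℤ, p ∣ b → (p : 𝓞 K) ∣ (z + b * ω) ^ 2 → (p : 𝓞 K) ∣ z + b * ω := by
    rintro z b ⟨c, rfl⟩ hz
    rw [h.dvd_iff]
    refine ⟨hp.dvd_of_dvd_pow (n := 2) ?_, dvd_mul_right _ _⟩
    rw [← h.intCast_dvd_iff]
    have : ((z ^ 2 : ℤ) : 𝓞 K) = (z + (p * c : ℤ) * ω) ^ 2
        - p * (2 * z * c * ω + p * c ^ 2 * ω ^ 2) := by push_cast; ring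
    rw [this]
    exact dvd_sub hz (dvd_mul_right _ _)
  choose x y hxy using fun i j => h.2 (α i j)
  have hy : ¬p ∣ y i j := by
    intro hpy
    apply hij
    rw [hxy]
    refine hint _ _ hpy ?_
    rw [← hxy, sq]
    exact hkO.trans (hsq i j i j)
  obtain ⟨s, t, hst⟩ := (hp.coprime_iff_not_dvd.2 hy : IsCoprime p (y i j))
  -- all entries are integral multiples of one of them modulo `p`
  have hr : ∀ i' j', ∃ β : 𝓞 K, α i' j' = (y i' j' * t : ℤ) * α i j + p * β := by
    intro i' j'
    have h1 : α i' j' - (y i' j' * t : ℤ) * α i j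
        = (x i' j' - y i' j' * t * x i j : ℤ) + (p * (s * y i' j') : ℤ) * ω := by
      have hst' : (s : 𝓞 K) * p + t * y i j = 1 := by
        exact_mod_cast congrArg (Int.cast : ℤ → 𝓞 K) hst
      rw [hxy i' j', hxy i j]
      push_cast
      linear_combination (-(y i' j' : 𝓞 K) * ω) * hst'
    have h2 : (p : 𝓞 K) ∣ α i' j' - (y i' j' * t : ℤ) * α i j := by
      rw [h1]
      refine hint _ _ (dvd_mul_right _ _) ?_
      rw [← h1]
      have : (α i' j' - (y i' j' * t : ℤ) * α i j) ^ 2 = α i' j' * α i' j'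
          - 2 * (y i' j' * t : ℤ) * (α i j * α i' j') + (y i' j' * t : ℤ) ^ 2 * (α i j * α i j) := by
        ring
      rw [this]
      exact dvd_add (dvd_sub (hkO.trans (hsq _ _ _ _)) ((hkO.trans (hsq _ _ _ _)).mul_left _))
        ((hkO.trans (hsq _ _ _ _)).mul_left _)
    obtain ⟨β, hβ⟩ := h2
    exact ⟨β, by linear_combination hβ⟩
  choose β hβ using hr
  -- As `α - α' = y (ω - ω')` entrywise, `hdiff` can be divided by `ω - ω'`; then compare
  -- `ω`-coordinates modulo `p`.
  have hdy : p ∣ y 0 0 * y 1 1 - y 0 1 * y 1 0 := by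
    obtain ⟨w, hw⟩ := hdiff
    have hsc : ∀ i j, α i j - conjInt K (α i j) = y i j * (ω - conjInt K ω) := by
      intro i j
      rw [hxy i j]
      simp only [map_add, map_mul, map_intCast]
      ring
    rw [hsc, hsc] at hw
    have h1 : α 0 0 * y 1 1 - α 0 1 * y 1 0 = k * w :=
      mul_right_cancel₀ h.1 (by linear_combination hw)
    have h2 : (p : 𝓞 K) ∣ (x 0 0 * y 1 1 - x 0 1 * y 1 0 : ℤ)
        + (y 0 0 * y 1 1 - y 0 1 * y 1 0 : ℤ) * ω := by
      refine hkO.trans ⟨w, ?_⟩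
      rw [← h1, hxy 0 0, hxy 0 1]
      push_cast
      ring
    exact (h.dvd_iff.1 h2).2
  obtain ⟨l, hl⟩ := hk
  obtain ⟨e, he⟩ := hdy
  obtain ⟨g, hg⟩ := hsq i j i j
  -- hence `l ≡ μ * α i j` modulo `p`
  obtain ⟨μ, ν, hl'⟩ : ∃ μ ν : 𝓞 K, (l : 𝓞 K) = α i j * μ + p * ν := by
    have he' : (y 0 0 : 𝓞 K) * y 1 1 - y 0 1 * y 1 0 = p * e := by
      exact_mod_cast congrArg (Int.cast : ℤ → 𝓞 K) he
    have hl2 : (k : 𝓞 K) = p * l := by exact_mod_cast congrArg (Int.cast : ℤ → 𝓞 K) hl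
    rw [Matrix.det_fin_two, hβ 0 0, hβ 0 1, hβ 1 0, hβ 1 1, hl2] at hdet
    push_cast at hdet
    -- Expansion of `det α` in the decomposition `hβ`. The quadratic term in `α i j` is divisible by
    -- `p²`, since both the determinant of `y` and `(α i j)²` are divisible by `p`; one factor `p`
    -- is cancelled.
    refine ⟨y 0 0 * t * β 1 1 + y 1 1 * t * β 0 0 - y 0 1 * t * β 1 0 - y 1 0 * t * β 0 1,
      t ^ 2 * e * l * g + β 0 0 * β 1 1 - β 0 1 * β 1 0, mul_left_cancel₀ hp0 ?_⟩
    rw [hl2] at hg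
    linear_combination -hdet + t ^ 2 * (α i j) ^ 2 * he' + t ^ 2 * p * e * hg
  -- Square `l ≡ μ * α i j`: the right side vanishes modulo `p`.
  have hpl : p ∣ l := by
    refine hp.dvd_of_dvd_pow (n := 2) ?_
    rw [← h.intCast_dvd_iff]
    have : ((l ^ 2 : ℤ) : 𝓞 K) = (α i j * α i j) * μ ^ 2
        + p * (2 * α i j * μ * ν + p * ν ^ 2) := by
      push_cast
      rw [hl']
      ring
    rw [this]
    exact dvd_add ((hkO.trans (hsq _ _ _ _)).mul_right _) (dvd_mul_right _ _)
  apply hk2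
  rw [hl, sq]
  exact mul_dvd_mul_left p hpl

end IsGen

end Arithmetic

/-! ### The lattice attached to an integral basis -/

section Lattice

lemma basis_expansion {K : IntermediateField ℚ ℝ} (B : Module.Basis (Fin 2) ℤ (𝓞 K)) (x : 𝓞 K) :
    ∃ a b : ℤ, x = a * B 0 + b * B 1 := by
  refine ⟨B.repr x 0, B.repr x 1, ?_⟩
  conv_lhs => rw [← B.sum_repr x]
  simp [Fin.sum_univ_two]

variable {K : IntermediateField ℚ ℝ} [Algebra.IsQuadraticExtension ℚ K]

/-- The pairs `(x y, x y')` span the pairs that are congruent modulo the different. -/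
lemma exists_tensor_coeff {ω : 𝓞 K} (h : IsGen ω) (B : Module.Basis (Fin 2) ℤ (𝓞 K))
    {m₁ m₂ : 𝓞 K} (hm : ω - conjInt K ω ∣ m₁ - m₂) :
    ∃ a b c d : ℤ,
      m₁ = a * (B 0 * B 0) + b * (B 0 * B 1) + c * (B 1 * B 0) + d * (B 1 * B 1) ∧
      m₂ = a * (B 0 * conjInt K (B 0)) + b * (B 0 * conjInt K (B 1)) +
        c * (B 1 * conjInt K (B 0)) + d * (B 1 * conjInt K (B 1)) := by
  obtain ⟨w, hw⟩ := hm
  -- In the basis `(1, ω)`, the coefficients of `1 ⊗ ω` and `ω ⊗ ω` are read off from `(m₁ - m₂) /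
  -- (ω - ω')`, those of `1 ⊗ 1` and `ω ⊗ 1` from the rest of `m₁`. Expanding `1` and `ω` in `B`
  -- gives the claim.
  obtain ⟨e, f, rfl⟩ := h.2 w
  obtain ⟨g, k, hgk⟩ := h.2 (m₁ - e * ω - f * ω ^ 2)
  obtain ⟨m, n, h1⟩ := basis_expansion B 1
  obtain ⟨s, t, hω⟩ := basis_expansion B ω
  have h1' := congrArg (conjInt K) h1
  have hω' := congrArg (conjInt K) hω
  simp only [map_add, map_mul, map_intCast, map_one] at h1' hω'
  refine ⟨g * m * m + e * m * s + k * s * m + f * s * s, g * m * n + e * m * t + k * s * n + f * s * t,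
    g * n * m + e * n * s + k * t * m + f * t * s, g * n * n + e * n * t + k * t * n + f * t * t,
    ?_, ?_⟩
  · have : m₁ = g * (1 * 1) + e * (1 * ω) + k * (ω * 1) + f * (ω * ω) := by
      linear_combination hgk
    rw [this]
    conv_lhs => rw [h1, hω]
    push_cast
    ring
  · have : m₂ = g * (1 * 1) + e * (1 * conjInt K ω) + k * (ω * 1) + f * (ω * conjInt K ω) := by
      linear_combination hgk - hw
    rw [this, hω']
    have e1 : (g * (1 * 1) + e * (1 * (s * conjInt K (B 0) + t * conjInt K (B 1))) + k * (ω * 1)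
        + f * (ω * (s * conjInt K (B 0) + t * conjInt K (B 1))) : 𝓞 K)
        = g * ((m * B 0 + n * B 1) * (m * conjInt K (B 0) + n * conjInt K (B 1)))
          + e * ((m * B 0 + n * B 1) * (s * conjInt K (B 0) + t * conjInt K (B 1)))
          + k * ((s * B 0 + t * B 1) * (m * conjInt K (B 0) + n * conjInt K (B 1)))
        + f * ((s * B 0 + t * B 1) * (s * conjInt K (B 0) + t * conjInt K (B 1))) := by
      rw [← h1, ← h1', ← hω]
    rw [e1]
    push_cast
    ring

/-- The general element of the lattice `Ĝ ℤ^{4 × 4} Ĝᵗ`. -/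
noncomputable def latMat (a b c d : ℤ) (p q r s m₁ m₂ : 𝓞 K) : Matrix (Fin 4) (Fin 4) ℝ :=
  !![(a : ℝ), emb K p, emb K (conjInt K p), (b : ℝ);
     emb K q, emb K m₁, emb K m₂, emb K r;
     emb K (conjInt K q), emb K (conjInt K m₂), emb K (conjInt K m₁), emb K (conjInt K r);
     (c : ℝ), emb K s, emb K (conjInt K s), (d : ℝ)]

lemma hat_mul_mul_transpose (G : Matrix (Fin 2) (Fin 2) ℝ) (X : Matrix (Fin 4) (Fin 4) ℝ) :
    hat G * X * (hat G)ᵀ =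
    !![X 0 0, X 0 1 * G 0 0 + X 0 2 * G 0 1, X 0 1 * G 1 0 + X 0 2 * G 1 1, X 0 3;
       X 1 0 * G 0 0 + X 2 0 * G 0 1,
       X 1 1 * (G 0 0 * G 0 0) + X 1 2 * (G 0 0 * G 0 1) + X 2 1 * (G 0 1 * G 0 0) +
         X 2 2 * (G 0 1 * G 0 1),
       X 1 1 * (G 0 0 * G 1 0) + X 1 2 * (G 0 0 * G 1 1) + X 2 1 * (G 0 1 * G 1 0) +
         X 2 2 * (G 0 1 * G 1 1),
       X 1 3 * G 0 0 + X 2 3 * G 0 1;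
       X 1 0 * G 1 0 + X 2 0 * G 1 1,
       X 1 1 * (G 1 0 * G 0 0) + X 1 2 * (G 1 0 * G 0 1) + X 2 1 * (G 1 1 * G 0 0) +
         X 2 2 * (G 1 1 * G 0 1),
       X 1 1 * (G 1 0 * G 1 0) + X 1 2 * (G 1 0 * G 1 1) + X 2 1 * (G 1 1 * G 1 0) +
         X 2 2 * (G 1 1 * G 1 1),
       X 1 3 * G 1 0 + X 2 3 * G 1 1;
       X 3 0, X 3 1 * G 0 0 + X 3 2 * G 0 1, X 3 1 * G 1 0 + X 3 2 * G 1 1, X 3 3] := by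
  ext i j
  fin_cases i <;> fin_cases j <;> 
    simp [hat, Matrix.mul_apply, Matrix.vecMul, dotProduct, Fin.sum_univ_four] <;> ring

/-- The middle block of `X` is a tensor in `𝓞 K ⊗ 𝓞 K`, mapped to `𝓞 K × 𝓞 K` by `x ⊗ y ↦ (xy,
xy')`. The image is cut out by the congruence modulo `ω - ω'`, the only condition beyond integrality
and conjugate symmetry. -/
lemma exists_latMat_iff {ω : 𝓞 K} (h : IsGen ω) (B : Module.Basis (Fin 2) ℤ (𝓞 K))
    (Z : Matrix (Fin 4) (Fin 4) ℝ) :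
    (∃ X ∈ integral (Fin 4), Z = hat (GMat B) * X * (hat (GMat B))ᵀ) ↔
      ∃ (a b c d : ℤ) (p q r s m₁ m₂ : 𝓞 K), ω - conjInt K ω ∣ m₁ - m₂ ∧
        Z = latMat a b c d p q r s m₁ m₂ := by
  constructor
  · rintro ⟨_, ⟨V, rfl⟩, rfl⟩
    refine ⟨V 0 0, V 0 3, V 3 0, V 3 3, V 0 1 * B 0 + V 0 2 * B 1, V 1 0 * B 0 + V 2 0 * B 1,
      V 1 3 * B 0 + V 2 3 * B 1, V 3 1 * B 0 + V 3 2 * B 1,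
      V 1 1 * (B 0 * B 0) + V 1 2 * (B 0 * B 1) + V 2 1 * (B 1 * B 0) + V 2 2 * (B 1 * B 1),
      V 1 1 * (B 0 * conjInt K (B 0)) + V 1 2 * (B 0 * conjInt K (B 1)) +
        V 2 1 * (B 1 * conjInt K (B 0)) + V 2 2 * (B 1 * conjInt K (B 1)), ?_, ?_⟩
    · obtain ⟨x, hx⟩ := h.dvd_sub_conj (B 0)
      obtain ⟨y, hy⟩ := h.dvd_sub_conj (B 1)
      refine ⟨V 1 1 * B 0 * x + V 1 2 * B 0 * y + V 2 1 * B 1 * x + V 2 2 * B 1 * y, ?_⟩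
      linear_combination (V 1 1 * B 0 + V 2 1 * B 1) * hx + (V 1 2 * B 0 + V 2 2 * B 1) * hy
    · rw [hat_mul_mul_transpose]
      simp [latMat, GMat, conjInt_conjInt]
  · rintro ⟨a, b, c, d, p, q, r, s, m₁, m₂, hm, rfl⟩
    obtain ⟨Y₀, Y₁, Y₂, Y₃, rfl, rfl⟩ := exists_tensor_coeff h B hm
    obtain ⟨p₀, p₁, rfl⟩ := basis_expansion B p
    obtain ⟨q₀, q₁, rfl⟩ := basis_expansion B q
    obtain ⟨r₀, r₁, rfl⟩ := basis_expansion B r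
    obtain ⟨s₀, s₁, rfl⟩ := basis_expansion B s
    refine ⟨_, ⟨!![a, p₀, p₁, b; q₀, Y₀, Y₁, r₀; q₁, Y₂, Y₃, r₁; c, s₀, s₁, d], rfl⟩, ?_⟩
    rw [hat_mul_mul_transpose]
    simp [latMat, GMat, conjInt_conjInt]

end Lattice

/-! ### Descent from real to integral matrices -/

section Descent

variable {K : IntermediateField ℚ ℝ} [Algebra.IsQuadraticExtension ℚ K]

lemma Omega_smul_smul (c : ℝ) (A B : Matrix (Fin 2) (Fin 2) ℝ) :
    Omega (c • A) (c • B) = c ^ 2 • Omega A B := by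
  simp only [Omega_apply]
  ext i j
  fin_cases i <;> fin_cases j <;> simp <;> ring

/-- If all products `A i j * B k l` are integral and conjugate to `A k l * B i j`, then `A` and `B`
have a common multiple that is a pair of conjugate integral matrices. -/
lemma exists_common_multiple {ω : 𝓞 K} (h : IsGen ω) {A B : Matrix (Fin 2) (Fin 2) ℝ}
    (hA : A.det = 1)
    (hE : ∀ i j k l, ∃ e : 𝓞 K, emb K e = A i j * B k l ∧ emb K (conjInt K e) = A k l * B i j)
    (hS : ∀ i j k l, ∃ e : 𝓞 K, emb K e = A i j * A k l ∧ emb K (conjInt K e) = B i j * B k l) :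
    ∃ (μ : ℝ) (α : Matrix (Fin 2) (Fin 2) (𝓞 K)), μ ≠ 0 ∧
      (∀ i j, emb K (α i j) = μ * A i j) ∧ ∀ i j, emb K (conjInt K (α i j)) = μ * B i j := by
  choose e he he' using hE
  choose g hg hg' using hS
  -- The multiplier `A i j + B i j` is a trace: conjugation formally exchanges `A` and `B`. If all
  -- traces vanish, then `B = -A` and a single entry is anti-invariant, which the factor `ω - ω'`
  -- repairs.
  by_cases hz : ∃ i j, A i j + B i j ≠ 0
  · obtain ⟨i, j, hij⟩ := hz
    refine ⟨A i j + B i j, fun k l => g k l i j + e k l i j, hij, fun k l => ?_, fun k l => ?_⟩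
    · rw [map_add, hg, he]; ring
    · rw [map_add, map_add, hg', he']; ring
  · push Not at hz
    have hB : ∀ i j, B i j = -A i j := fun i j => by linarith [hz i j]
    obtain ⟨i, j, hij⟩ : ∃ i j, A i j ≠ 0 := by
      by_contra! hc
      simp [Matrix.det_fin_two, hc] at hA
    have hθ : emb K (ω - conjInt K ω) ≠ 0 := by
      rw [Ne, map_eq_zero_iff _ (emb_injective K)]
      exact h.1
    refine ⟨A i j * emb K (ω - conjInt K ω), fun k l => g k l i j * (ω - conjInt K ω),
      mul_ne_zero hij hθ, fun k l => ?_, fun k l => ?_⟩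
    · rw [map_mul, hg]; ring
    · have : conjInt K (ω - conjInt K ω) = -(ω - conjInt K ω) := by
        rw [map_sub, conjInt_conjInt]; ring
      rw [map_mul, map_mul, hg', this, map_neg, hB, hB]
      ring

lemma exists_int_det {ω : 𝓞 K} (h : IsGen ω) {A B : Matrix (Fin 2) (Fin 2) ℝ}
    (hA : A.det = 1) (hB : B.det = 1) {μ : ℝ} {α : Matrix (Fin 2) (Fin 2) (𝓞 K)}
    (hα : ∀ i j, emb K (α i j) = μ * A i j) (hα' : ∀ i j, emb K (conjInt K (α i j)) = μ * B i j) :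
    ∃ k : ℕ, α.det = (k : ℤ) ∧ (k : ℝ) = μ ^ 2 := by
  rw [Matrix.det_fin_two] at hA hB
  have h1 : emb K α.det = μ ^ 2 := by
    rw [Matrix.det_fin_two]
    simp only [map_sub, map_mul, hα]
    linear_combination μ ^ 2 * hA
  have h2 : emb K (conjInt K α.det) = μ ^ 2 := by
    rw [Matrix.det_fin_two]
    simp only [map_sub, map_mul, hα']
    linear_combination μ ^ 2 * hB
  obtain ⟨n, hn⟩ := h.exists_int_of_conj_eq (emb_injective K (h2.trans h1.symm))
  have h3 : (n : ℝ) = μ ^ 2 := by rw [← h1, hn, map_intCast]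
  have h4 : 0 ≤ n := by
    have : (0 : ℝ) ≤ n := h3 ▸ sq_nonneg μ
    exact_mod_cast this
  obtain ⟨k, rfl⟩ := Int.eq_ofNat_of_zero_le h4
  exact ⟨k, hn, by exact_mod_cast h3⟩

/-- A common multiple of the shape above can be made unimodular. -/
lemma exists_unimodular_multiple {ω : 𝓞 K} (h : IsGen ω) {A B : Matrix (Fin 2) (Fin 2) ℝ}
    (hA : A.det = 1) (hB : B.det = 1)
    (hS : ∀ i j k l, ∃ e : 𝓞 K, emb K e = A i j * A k l)
    (hdiff : ∃ w : 𝓞 K, A 0 0 * (A 1 1 - B 1 1) - A 0 1 * (A 1 0 - B 1 0)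
      = emb K ((ω - conjInt K ω) * w)) (n : ℕ) :
    ∀ (μ : ℝ) (α : Matrix (Fin 2) (Fin 2) (𝓞 K)), (n : ℝ) = μ ^ 2 → μ ≠ 0 →
      (∀ i j, emb K (α i j) = μ * A i j) → (∀ i j, emb K (conjInt K (α i j)) = μ * B i j) →
      ∃ (ν : ℝ) (β : Matrix (Fin 2) (Fin 2) (𝓞 K)), ν ^ 2 = 1 ∧ β.det = 1 ∧
        (∀ i j, emb K (β i j) = ν * A i j) ∧ ∀ i j, emb K (conjInt K (β i j)) = ν * B i j := by
  -- Descent on the determinant `n = μ²`: dividing all entries by a prime factor `p` divides it by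
  -- `p²`.
  induction n using Nat.strong_induction_on with
  | _ n ih =>
  intro μ α hn hμ hα hα'
  obtain ⟨k, hk, hkμ⟩ := exists_int_det h hA hB hα hα'
  obtain rfl : k = n := by exact_mod_cast hkμ.trans hn.symm
  by_cases hk1 : k = 1
  · subst hk1
    exact ⟨μ, α, by simpa using hn.symm, by simpa using hk, hα, hα'⟩
  set p := k.minFac with hpdef
  have hp : p.Prime := Nat.minFac_prime hk1
  have hpZ : Prime (p : ℤ) := Nat.prime_iff_prime_int.1 hp
  have hdvd : ∀ i j, ((p : ℤ) : 𝓞 K) ∣ α i j := by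
    refine h.prime_dvd_entries hpZ (by exact_mod_cast Nat.minFac_dvd k) α hk ?_ ?_
    · intro i j i' j'
      obtain ⟨e, he⟩ := hS i j i' j'
      refine ⟨e, emb_injective K ?_⟩
      rw [map_mul, map_mul, hα, hα, he, map_intCast, Int.cast_natCast, hn]
      ring
    · obtain ⟨w, hw⟩ := hdiff
      refine ⟨w, emb_injective K ?_⟩
      rw [mul_assoc, map_mul, ← hw]
      have hkO : emb K ((k : ℤ) : 𝓞 K) = μ ^ 2 := by rw [map_intCast, Int.cast_natCast, hn]
      rw [hkO]
      simp only [map_mul, map_sub, hα, hα']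
      ring
  choose β hβ using hdvd
  have hp0 : (p : ℝ) ≠ 0 := by exact_mod_cast hp.ne_zero
  have hβ1 : ∀ i j, emb K (β i j) = μ / p * A i j := by
    intro i j
    have := hα i j
    rw [hβ, map_mul, map_intCast, Int.cast_natCast] at this
    field_simp
    linarith
  have hβ2 : ∀ i j, emb K (conjInt K (β i j)) = μ / p * B i j := by
    intro i j
    have := hα' i j
    rw [hβ, map_mul, map_mul, map_intCast, map_intCast, Int.cast_natCast] at this
    field_simp
    linarith
  obtain ⟨l, -, hl⟩ := exists_int_det (α := Matrix.of β) h hA hB hβ1 hβ2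
  refine ih l ?_ (μ / p) (Matrix.of β) hl (div_ne_zero hμ hp0) hβ1 hβ2
  have hkpos : 0 < (k : ℝ) := by rw [hn]; positivity
  have hp1 : (1 : ℝ) < p ^ 2 := by
    have : (1 : ℝ) < p := by exact_mod_cast hp.one_lt
    nlinarith
  have : (l : ℝ) < k := by
    rw [hl, div_pow, ← hn]
    exact div_lt_self hkpos hp1
  exact_mod_cast this

/-- Pairs of real matrices for which `Ω(A, B) - 1` lies in the lattice come from the
Hilbert modular group. -/
theorem exists_hilbert_of_latMat {ω : 𝓞 K} (h : IsGen ω) {A B : Matrix (Fin 2) (Fin 2) ℝ}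
    (hA : A.det = 1) (hB : B.det = 1) {a b c d : ℤ} {p q r s m₁ m₂ : 𝓞 K}
    (hm : ω - conjInt K ω ∣ m₁ - m₂)
    (hW : Omega A B = 1 + latMat a b c d p q r s m₁ m₂ * splitForm) :
    ∃ M : HilbertGroup K, Omega A B = Omega (realMat K M) (realMatConj K M) := by
  have hW' : ∀ i j, Omega A B i j
      = (1 + latMat a b c d p q r s m₁ m₂ * splitForm) i j := fun i j => by rw [hW]
  have hA' := hA
  have hB' := hB
  rw [Matrix.det_fin_two] at hA' hB'
  have hsymm : ∀ i j k l, (∃ e : 𝓞 K, emb K e = A i j * B k l ∧ emb K (conjInt K e) = A k l * B i j)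
      → ∃ e : 𝓞 K, emb K e = A k l * B i j ∧ emb K (conjInt K e) = A i j * B k l := by
    rintro i j k l ⟨e, h1, h2⟩
    exact ⟨conjInt K e, h2, by rw [conjInt_conjInt, h1]⟩
  simp only [Omega_apply, latMat, splitForm] at hW'
  have w00 := hW' 0 0
  have w01 := hW' 0 1
  have w02 := hW' 0 2
  have w03 := hW' 0 3
  have w10 := hW' 1 0
  have w11 := hW' 1 1
  have w12 := hW' 1 2
  have w13 := hW' 1 3
  have w20 := hW' 2 0
  have w21 := hW' 2 1
  have w22 := hW' 2 2
  have w23 := hW' 2 3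
  have w30 := hW' 3 0
  have w31 := hW' 3 1
  have w32 := hW' 3 2
  have w33 := hW' 3 3
  simp at w00 w01 w02 w03 w10 w11 w12 w13 w20 w21 w22 w23 w30 w31 w32 w33
  -- The entries of `Ω(A, B)` are, up to sign, all the products of an entry of `A` and one of `B`;
  -- conjugation exchanges the two index pairs.
  have e01 : ∃ e : 𝓞 K, emb K e = A 0 0 * B 0 1 ∧ emb K (conjInt K e) = A 0 1 * B 0 0 :=
    ⟨-conjInt K p, by simp; linarith, by simp [conjInt_conjInt]; linarith⟩
  have e02 : ∃ e : 𝓞 K, emb K e = A 0 0 * B 1 0 ∧ emb K (conjInt K e) = A 1 0 * B 0 0 :=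
    ⟨-r, by simp; linarith, by simp; linarith⟩
  have e03 : ∃ e : 𝓞 K, emb K e = A 0 0 * B 1 1 ∧ emb K (conjInt K e) = A 1 1 * B 0 0 :=
    ⟨1 + m₂, by simp; linarith, by simp; linarith⟩
  have e12 : ∃ e : 𝓞 K, emb K e = A 0 1 * B 1 0 ∧ emb K (conjInt K e) = A 1 0 * B 0 1 :=
    ⟨m₁, by linarith, by linarith⟩
  have e13 : ∃ e : 𝓞 K, emb K e = A 0 1 * B 1 1 ∧ emb K (conjInt K e) = A 1 1 * B 0 1 :=
    ⟨q, by linarith, by linarith⟩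
  have e23 : ∃ e : 𝓞 K, emb K e = A 1 0 * B 1 1 ∧ emb K (conjInt K e) = A 1 1 * B 1 0 :=
    ⟨conjInt K s, by linarith, by rw [conjInt_conjInt]; linarith⟩
  have hE : ∀ i j k l, ∃ e : 𝓞 K, emb K e = A i j * B k l ∧
      emb K (conjInt K e) = A k l * B i j := by
    have e00 : ∃ e : 𝓞 K, emb K e = A 0 0 * B 0 0 ∧ emb K (conjInt K e) = A 0 0 * B 0 0 :=
      ⟨(1 + b : ℤ), by simp; linarith, by simp; linarith⟩
    have e11 : ∃ e : 𝓞 K, emb K e = A 0 1 * B 0 1 ∧ emb K (conjInt K e) = A 0 1 * B 0 1 :=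
      ⟨(-a : ℤ), by simp; linarith, by simp; linarith⟩
    have e22 : ∃ e : 𝓞 K, emb K e = A 1 0 * B 1 0 ∧ emb K (conjInt K e) = A 1 0 * B 1 0 :=
      ⟨(-d : ℤ), by simp; linarith, by simp; linarith⟩
    have e33 : ∃ e : 𝓞 K, emb K e = A 1 1 * B 1 1 ∧ emb K (conjInt K e) = A 1 1 * B 1 1 :=
      ⟨(1 + c : ℤ), by simp; linarith, by simp; linarith⟩
    intro i j k l
    fin_cases i <;> fin_cases j <;> fin_cases k <;> fin_cases l <;>
      first | assumption | (refine hsymm _ _ _ _ ?_; assumption)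
  have hS : ∀ i j k l, ∃ e : 𝓞 K, emb K e = A i j * A k l ∧
      emb K (conjInt K e) = B i j * B k l := by
    intro i j k l
    -- Multiply `A i j * A k l` by `det B = 1` and regroup into mixed products; for the conjugates
    -- use `det A = 1`.
    obtain ⟨f₁, h1, h1'⟩ := hE i j 0 0
    obtain ⟨f₂, h2, h2'⟩ := hE k l 1 1
    obtain ⟨f₃, h3, h3'⟩ := hE i j 0 1
    obtain ⟨f₄, h4, h4'⟩ := hE k l 1 0
    refine ⟨f₁ * f₂ - f₃ * f₄, ?_, ?_⟩
    · rw [map_sub, map_mul, map_mul, h1, h2, h3, h4]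
      linear_combination A i j * A k l * hB'
    · simp only [map_sub, map_mul, h1', h2', h3', h4']
      linear_combination B i j * B k l * hA'
  have hdiff : ∃ w : 𝓞 K, A 0 0 * (A 1 1 - B 1 1) - A 0 1 * (A 1 0 - B 1 0)
      = emb K ((ω - conjInt K ω) * w) := by
    obtain ⟨w, hw⟩ := hm
    refine ⟨w, ?_⟩
    rw [← hw, map_sub]
    -- Since `det A = 1`, the left side is `1 - A 0 0 * B 1 1 + A 0 1 * B 1 0`, that is `m₁ - m₂`.
    linear_combination hA' - w11 + w12
  obtain ⟨μ, α, hμ, hα, hα'⟩ := exists_common_multiple h hA hE hS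
  obtain ⟨k, -, hk⟩ := exists_int_det h hA hB hα hα'
  obtain ⟨ν, β, hν, hdet, hβ, hβ'⟩ := exists_unimodular_multiple h hA hB
    (fun i j k l => (hS i j k l).imp fun _ he => he.1) hdiff k μ α hk hμ hα hα'
  refine ⟨⟨β, hdet⟩, ?_⟩
  have h1 : realMat K ⟨β, hdet⟩ = ν • A := by
    ext i j
    simpa [realMat] using hβ i j
  have h2 : realMatConj K ⟨β, hdet⟩ = ν • B := by
    ext i j
    simpa [realMatConj] using hβ' i j
  rw [h1, h2, Omega_smul_smul, hν, one_smul]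

end Descent

/-! ### Integral matrices -/

section Integral

variable {n : Type*}

lemma one_mem_integral [DecidableEq n] : (1 : Matrix n n ℝ) ∈ integral n :=
  ⟨1, by simp⟩

lemma add_mem_integral {U V : Matrix n n ℝ} (hU : U ∈ integral n) (hV : V ∈ integral n) :
    U + V ∈ integral n := by
  obtain ⟨U, rfl⟩ := hU
  obtain ⟨V, rfl⟩ := hV
  exact ⟨U + V, by ext; simp⟩

lemma mul_mem_integral [Fintype n] {U V : Matrix n n ℝ} (hU : U ∈ integral n)
    (hV : V ∈ integral n) : U * V ∈ integral n := by
  obtain ⟨U, rfl⟩ := hU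
  obtain ⟨V, rfl⟩ := hV
  exact ⟨U * V, by ext; simp [Matrix.mul_apply]⟩

lemma natCast_smul_mem_integral {U : Matrix n n ℝ} (N : ℕ) (hU : U ∈ integral n) :
    (N : ℝ) • U ∈ integral n := by
  obtain ⟨U, rfl⟩ := hU
  exact ⟨(N : ℤ) • U, by ext; simp⟩

lemma FMat_mem_integral (N : ℕ) : FMat N ∈ integral (Fin 4) :=
  ⟨Matrix.diagonal ![1, 1, 1, (N : ℤ)], by
    ext i j
    fin_cases i <;> fin_cases j <;> simp [FMat]⟩

end Integral

/-- Transports the discriminant kernel to the form `T`. Integrality of `V` costs nothing: it follows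
from `V = 1 + X T'`, with `T'` the integral rescaled form. -/
lemma mem_discKernel_iff {n : Type*} [Fintype n] [DecidableEq n] {T H : Matrix n n ℝ} {c : ℝ}
    (hc : c ≠ 0) (hH : IsUnit H.det) (hT : c • (Hᵀ * T * H) ∈ integral n) {V : Matrix n n ℝ} :
    V ∈ discKernel (c • (Hᵀ * T * H)) ↔ H * V * H⁻¹ ∈ SOZero T ∧
      ∃ X ∈ integral n, H * V * H⁻¹ = 1 + c • (H * X * Hᵀ) * T := by
  have key : ∀ X : Matrix n n ℝ, V = 1 + X * (c • (Hᵀ * T * H)) ↔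
      H * V * H⁻¹ = 1 + c • (H * X * Hᵀ) * T := by
    intro X
    have e1 : H * (1 + X * (c • (Hᵀ * T * H))) * H⁻¹ = 1 + c • (H * X * Hᵀ) * T := by
      rw [mul_add, add_mul, mul_one, Matrix.mul_nonsing_inv _ hH]
      simp only [Matrix.mul_smul, Matrix.smul_mul, mul_assoc]
      rw [Matrix.mul_nonsing_inv _ hH, mul_one]
    rw [← e1]
    constructor
    · rintro h
      rw [← h]
    · intro h
      have h2 := congrArg (fun W => H⁻¹ * W * H) h
      have h3 : ∀ W : Matrix n n ℝ, H⁻¹ * (H * W * H⁻¹) * H = W := by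
        intro W
        rw [mul_assoc H, ← mul_assoc, ← mul_assoc, Matrix.nonsing_inv_mul _ hH, one_mul, mul_assoc,
          Matrix.nonsing_inv_mul _ hH, mul_one]
      simpa only [h3] using h2
  constructor
  · rintro ⟨⟨h1, -⟩, X, hX, h2⟩
    rw [SOZero_smul hc, mem_SOZero_congr_iff hH] at h1
    exact ⟨h1, X, hX, (key X).1 h2⟩
  · rintro ⟨h1, X, hX, h2⟩
    have h3 := (key X).2 h2
    refine ⟨⟨?_, ?_⟩, X, hX, h3⟩
    · rwa [SOZero_smul hc, mem_SOZero_congr_iff hH]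
    · rw [h3]
      exact add_mem_integral one_mem_integral (mul_mem_integral hX hT)

/-! ### Images of subgroups of `Γ_K` and discriminant kernels -/

section Images

variable {K : IntermediateField ℚ ℝ} [Algebra.IsQuadraticExtension ℚ K]

lemma det_realMat {K : IntermediateField ℚ ℝ} (M : HilbertGroup K) : (realMat K M).det = 1 := by
  have := (emb K).map_det (M : Matrix (Fin 2) (Fin 2) (𝓞 K))
  rw [M.det_coe, map_one] at this
  exact this.symm

lemma det_realMatConj (M : HilbertGroup K) : (realMatConj K M).det = 1 := by
  have := ((emb K).comp (conjInt K)).map_det (M : Matrix (Fin 2) (Fin 2) (𝓞 K))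
  rw [M.det_coe, map_one] at this
  exact this.symm

lemma hyp_gram_eq (B : Module.Basis (Fin 2) ℤ (𝓞 K)) (N : ℕ) :
    hyp (gram B) N = (hat (GMat B) * FMat N)ᵀ * splitForm * (hat (GMat B) * FMat N) := by
  have h1 : (hat (GMat B) * FMat N) = !![1, 0, 0, 0; 0, GMat B 0 0, GMat B 0 1, 0;
      0, GMat B 1 0, GMat B 1 1, 0; 0, 0, 0, (N : ℝ)] := by
    ext i j
    fin_cases i <;> fin_cases j <;> simp [hat, FMat]
  rw [h1]
  ext i j
  fin_cases i <;> fin_cases j <;>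
    simp [hyp, gram, PMat, splitForm, Matrix.mul_apply, Fin.sum_univ_succ]

lemma hyp_gram_mem_integral (B : Module.Basis (Fin 2) ℤ (𝓞 K)) (N : ℕ) :
    hyp (gram B) N ∈ integral (Fin 4) := by
  obtain ⟨ω, h⟩ := exists_isGen B
  have key : ∀ x y : 𝓞 K, ∃ n : ℤ, emb K x * emb K (conjInt K y) + emb K (conjInt K x) * emb K y
      = n := by
    intro x y
    obtain ⟨n, hn⟩ := h.exists_int_of_conj_eq (x := x * conjInt K y + conjInt K x * y)
      (by simp only [map_add, map_mul, conjInt_conjInt]; ring)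
    exact ⟨n, by simpa using congrArg (emb K) hn⟩
  choose f hf using fun i j => key (B i) (B j)
  refine ⟨!![0, 0, 0, N; 0, f 0 0, f 0 1, 0; 0, f 1 0, f 1 1, 0; N, 0, 0, 0], ?_⟩
  ext i j
  fin_cases i <;> fin_cases j <;>
    simp [hyp, gram, PMat, GMat, Matrix.mul_apply, ← hf] <;> ring

lemma phi_image_modPM (B : Module.Basis (Fin 2) ℤ (𝓞 K)) (Γ : Subgroup (HilbertGroup K)) :
    phi B '' (modPM K Γ : Set _) = tilde B '' (Γ : Set _) := by
  rw [modPM, Subgroup.coe_map, Set.image_image]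
  rfl

/-- A subgroup of the Hilbert modular group that is described by a sublattice has the
corresponding discriminant kernel as its image. -/
lemma image_eq_discKernel (B : Module.Basis (Fin 2) ℤ (𝓞 K)) (Γ : Subgroup (HilbertGroup K))
    {F : Matrix (Fin 4) (Fin 4) ℝ} (hF : IsUnit F.det) (hFi : F ∈ integral (Fin 4))
    (hFt : Fᵀ = F) (hFG : hat (GMat B) * F = F * hat (GMat B)) {N : ℕ} (hN : 0 < N)
    (hT : (N : ℝ) • ((hat (GMat B) * F)ᵀ * splitForm * (hat (GMat B) * F)) ∈ integral (Fin 4))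
    (hΓ : ∀ M, M ∈ Γ ↔ ∃ X ∈ integral (Fin 4), Omega (realMat K M) (realMatConj K M)
      = 1 + (N : ℝ) • (F * (hat (GMat B) * X * (hat (GMat B))ᵀ) * F) * splitForm) :
    phi B '' (modPM K Γ : Set _) = (fun U => F * U * F⁻¹) ''
      discKernel ((N : ℝ) • ((hat (GMat B) * F)ᵀ * splitForm * (hat (GMat B) * F))) := by
  obtain ⟨ω, h⟩ := exists_isGen B
  have hN' : (N : ℝ) ≠ 0 := by exact_mod_cast hN.ne'
  have hG : IsUnit (hat (GMat B)).det := by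
    rw [det_hat]; exact (det_GMat_ne_zero B).isUnit
  have hH : IsUnit (hat (GMat B) * F).det := by
    rw [Matrix.det_mul]; exact hG.mul hF
  have hFG' : F * (hat (GMat B))ᵀ = (hat (GMat B))ᵀ * F := by
    have := congrArg Matrix.transpose hFG
    rwa [Matrix.transpose_mul, Matrix.transpose_mul, hFt] at this
  have hX : ∀ X : Matrix (Fin 4) (Fin 4) ℝ, hat (GMat B) * F * X * (hat (GMat B) * F)ᵀ
      = F * (hat (GMat B) * X * (hat (GMat B))ᵀ) * F := by
    intro X
    rw [Matrix.transpose_mul, hFt, hFG', hFG]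
    simp only [mul_assoc]
  have hconj : ∀ V : Matrix (Fin 4) (Fin 4) ℝ, F * V * F⁻¹ = (hat (GMat B))⁻¹ *
      ((hat (GMat B) * F) * V * (hat (GMat B) * F)⁻¹) * hat (GMat B) := by
    intro V
    rw [Matrix.mul_inv_rev]
    simp only [mul_assoc]
    rw [Matrix.nonsing_inv_mul _ hG, mul_one, ← mul_assoc (hat (GMat B))⁻¹,
      Matrix.nonsing_inv_mul _ hG, one_mul]
  rw [phi_image_modPM]
  ext U
  constructor
  · rintro ⟨M, hM, rfl⟩
    have hV : (hat (GMat B) * F) * ((hat (GMat B) * F)⁻¹ *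
        Omega (realMat K M) (realMatConj K M) * (hat (GMat B) * F)) * (hat (GMat B) * F)⁻¹
        = Omega (realMat K M) (realMatConj K M) := by
      generalize hat (GMat B) * F = H at hH
      rw [← mul_assoc, ← mul_assoc, Matrix.mul_nonsing_inv _ hH, one_mul, mul_assoc,
        Matrix.mul_nonsing_inv _ hH, mul_one]
    refine ⟨(hat (GMat B) * F)⁻¹ * Omega (realMat K M) (realMatConj K M) * (hat (GMat B) * F),
      (mem_discKernel_iff hN' hH hT).2 ⟨?_, ?_⟩, ?_⟩
    · rw [hV]
      exact Omega_mem_SOZero (det_realMat M) (det_realMatConj M)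
    · simp only [hV, hX]
      exact (hΓ M).1 hM
    · simp only [hconj, hV]
      rfl
  · rintro ⟨V, hV, rfl⟩
    obtain ⟨h1, X, hXi, h2⟩ := (mem_discKernel_iff hN' hH hT).1 hV
    obtain ⟨A, A', hA, hA', h3⟩ := mem_SOZero_splitForm_iff.1 h1
    -- Being integral and commuting with `Ĝ`, `F` can be absorbed into `X`. The sublattice thus lies
    -- in the full lattice, where the descent applies; the finer condition returns through `hΓ`.
    obtain ⟨a, b, c, d, p, q, r, s, m₁, m₂, hm, h4⟩ := (exists_latMat_iff h B _).1
      ⟨(N : ℝ) • (F * X * F),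
        natCast_smul_mem_integral N (mul_mem_integral (mul_mem_integral hFi hXi) hFi), rfl⟩
    have h5 : (N : ℝ) • (hat (GMat B) * F * X * (hat (GMat B) * F)ᵀ)
        = latMat a b c d p q r s m₁ m₂ := by
      rw [← h4, Matrix.transpose_mul, hFt, Matrix.mul_smul, Matrix.smul_mul]
      simp only [mul_assoc]
    obtain ⟨M, hM⟩ := exists_hilbert_of_latMat h hA hA' hm (by rw [← h3, h2, h5])
    refine ⟨M, (hΓ M).2 ⟨X, hXi, ?_⟩, ?_⟩
    · rw [← hM, ← h3, h2, hX]
    · simp only [hconj, h3, hM]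
      rfl

end Images

/-! ### The congruence subgroups in terms of lattices -/

section Congruence

variable {K : IntermediateField ℚ ℝ} [Algebra.IsQuadraticExtension ℚ K]

lemma Omega_realMat (M : HilbertGroup K) : Omega (realMat K M) (realMatConj K M) =
    !![emb K (M 0 0 * conjInt K (M 0 0)), emb K (-(M 0 0 * conjInt K (M 0 1))),
        emb K (-(M 0 1 * conjInt K (M 0 0))), emb K (-(M 0 1 * conjInt K (M 0 1)));
       emb K (-(M 0 0 * conjInt K (M 1 0))), emb K (M 0 0 * conjInt K (M 1 1)),
        emb K (M 0 1 * conjInt K (M 1 0)), emb K (M 0 1 * conjInt K (M 1 1));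
       emb K (-(M 1 0 * conjInt K (M 0 0))), emb K (M 1 0 * conjInt K (M 0 1)),
        emb K (M 1 1 * conjInt K (M 0 0)), emb K (M 1 1 * conjInt K (M 0 1));
       emb K (-(M 1 0 * conjInt K (M 1 0))), emb K (M 1 0 * conjInt K (M 1 1)),
        emb K (M 1 1 * conjInt K (M 1 0)), emb K (M 1 1 * conjInt K (M 1 1))] := by
  rw [Omega_apply]
  simp [realMat, realMatConj]

/-- The equation defining the lattice, entry by entry in the ring of integers. -/
lemma Omega_eq_latMat_iff (M : HilbertGroup K) (a b c d : ℤ) (p q r s m₁ m₂ : 𝓞 K) :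
    Omega (realMat K M) (realMatConj K M) = 1 + latMat a b c d p q r s m₁ m₂ * splitForm ↔
      (M 0 1 * conjInt K (M 0 1) = -a ∧ M 0 0 * conjInt K (M 0 0) = 1 + b ∧
      M 1 1 * conjInt K (M 1 1) = 1 + c ∧ M 1 0 * conjInt K (M 1 0) = -d) ∧
      (M 0 1 * conjInt K (M 0 0) = -p ∧ M 0 1 * conjInt K (M 1 1) = q ∧
      M 0 0 * conjInt K (M 1 0) = -r ∧ M 1 1 * conjInt K (M 1 0) = s) ∧
      M 0 1 * conjInt K (M 1 0) = m₁ ∧ M 0 0 * conjInt K (M 1 1) = 1 + m₂ := by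
  have hR : 1 + latMat a b c d p q r s m₁ m₂ * splitForm =
      !![emb K (1 + b), emb K (conjInt K p), emb K p, emb K a;
         emb K r, emb K (1 + m₂), emb K m₁, emb K q;
         emb K (conjInt K r), emb K (conjInt K m₁), emb K (1 + conjInt K m₂), emb K (conjInt K q);
         emb K d, emb K (conjInt K s), emb K s, emb K (1 + c)] := by
    ext i j
    fin_cases i <;> fin_cases j <;> simp [latMat, splitForm]
  rw [hR, Omega_realMat]
  constructor
  · intro h
    have h' : ∀ i j, _ := fun i j => congrFun (congrFun h i) j
    refine ⟨⟨?_, ?_, ?_, ?_⟩, ⟨?_, ?_, ?_, ?_⟩, ?_, ?_⟩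
    · exact neg_eq_iff_eq_neg.1 (emb_injective K (h' 0 3))
    · exact emb_injective K (h' 0 0)
    · exact emb_injective K (h' 3 3)
    · exact neg_eq_iff_eq_neg.1 (emb_injective K (h' 3 0))
    · exact neg_eq_iff_eq_neg.1 (emb_injective K (h' 0 2))
    · exact emb_injective K (h' 1 3)
    · exact neg_eq_iff_eq_neg.1 (emb_injective K (h' 1 0))
    · exact emb_injective K (h' 3 2)
    · exact emb_injective K (h' 1 2)
    · exact emb_injective K (h' 1 1)
  -- The remaining six of the sixteen entries are the conjugates of six of these ten.
  · rintro ⟨⟨h1, h2, h3, h4⟩, ⟨h5, h6, h7, h8⟩, h9, h10⟩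
    have h5' := congrArg (conjInt K) h5
    have h6' := congrArg (conjInt K) h6
    have h7' := congrArg (conjInt K) h7
    have h8' := congrArg (conjInt K) h8
    have h9' := congrArg (conjInt K) h9
    have h10' := congrArg (conjInt K) h10
    simp only [map_mul, map_neg, map_add, map_one, conjInt_conjInt] at h5' h6' h7' h8' h9' h10'
    rw [mul_comm] at h5' h6' h7' h8' h9' h10'
    rw [h1, h2, h3, h4, h5, h6, h7, h8, h9, h10, h5', h6', h7', h8', h9', h10']
    simp only [neg_neg]

lemma FMat_mul_latMat_mul_FMat (N : ℕ) (a b c d : ℤ) (p q r s m₁ m₂ : 𝓞 K) :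
    FMat N * latMat a b c d p q r s m₁ m₂ * FMat N =
      latMat a (N * b) (N * c) (N ^ 2 * d) p q (N * r) (N * s) m₁ m₂ := by
  rw [FMat]
  ext i j
  rw [Matrix.mul_diagonal, Matrix.diagonal_mul]
  fin_cases i <;> fin_cases j <;> simp [latMat] <;> ring

lemma smul_latMat (N : ℕ) (a b c d : ℤ) (p q r s m₁ m₂ : 𝓞 K) :
    (N : ℝ) • latMat a b c d p q r s m₁ m₂ =
      latMat (K := K) (N * a) (N * b) (N * c) (N * d) (N * p) (N * q) (N * r) (N * s)
        (N * m₁) (N * m₂) := by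
  simp [latMat]

lemma mem_gammaUpper_iff (B : Module.Basis (Fin 2) ℤ (𝓞 K)) {N : ℕ} (hN : 0 < N)
    (M : HilbertGroup K) : M ∈ gammaUpper K N ↔ ∃ X ∈ integral (Fin 4),
      Omega (realMat K M) (realMatConj K M)
        = 1 + FMat N * (hat (GMat B) * X * (hat (GMat B))ᵀ) * FMat N * splitForm := by
  obtain ⟨ω, h⟩ := exists_isGen B
  have hN0 : (N : 𝓞 K) ≠ 0 := by exact_mod_cast hN.ne'
  have hint : ∀ x : 𝓞 K, ∃ n : ℤ, x * conjInt K x = n := fun x =>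
    h.exists_int_of_conj_eq (by rw [map_mul, conjInt_conjInt, mul_comm])
  have hdet : M 0 0 * M 1 1 - M 0 1 * M 1 0 = 1 := by
    rw [← Matrix.det_fin_two]; exact M.det_coe
  have hnorm : ∀ x : 𝓞 K, (N : 𝓞 K) ∣ x * conjInt K x - 1 →
      ∃ n : ℤ, x * conjInt K x = 1 + N * n := by
    rintro x ⟨y, hy⟩
    have h1 : conjInt K y = y := by
      apply mul_left_cancel₀ hN0
      have := congrArg (conjInt K) hy
      simp only [map_sub, map_mul, map_one, map_natCast, conjInt_conjInt] at this
      linear_combination hy - this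
    obtain ⟨n, rfl⟩ := h.exists_int_of_conj_eq h1
    exact ⟨n, by linear_combination hy⟩
  constructor
  · rintro ⟨h1, h2, g, hg⟩
    obtain ⟨b, hb⟩ := hnorm _ h1
    obtain ⟨c, hc⟩ := hnorm _ h2
    obtain ⟨a, ha⟩ := hint (M 0 1)
    obtain ⟨d, hd⟩ := hint g
    have hg' : conjInt K (M 1 0) = N * conjInt K g := by rw [hg, map_mul, map_natCast]
    -- The congruence modulo the different is automatic on `Γ_K`: substitute `det M = 1`, and
    -- differences of conjugates are divisible by `ω - ω'`.
    have hm : ω - conjInt K ω ∣ M 0 1 * conjInt K (M 1 0) - (M 0 0 * conjInt K (M 1 1) - 1) := by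
      obtain ⟨x, hx⟩ := h.dvd_sub_conj (M 1 1)
      obtain ⟨y, hy⟩ := h.dvd_sub_conj (M 1 0)
      exact ⟨M 0 0 * x - M 0 1 * y, by linear_combination M 0 0 * hx - M 0 1 * hy - hdet⟩
    obtain ⟨X, hX, hXe⟩ := (exists_latMat_iff h B _).2
      ⟨-a, b, c, -d, -(M 0 1 * conjInt K (M 0 0)), M 0 1 * conjInt K (M 1 1),
        -(M 0 0 * conjInt K g), M 1 1 * conjInt K g, _, _, hm, rfl⟩
    refine ⟨X, hX, ?_⟩
    rw [← hXe, FMat_mul_latMat_mul_FMat, Omega_eq_latMat_iff]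
    push_cast
    refine ⟨⟨by rw [ha]; ring, hb, hc, ?_⟩, ⟨by ring, rfl, ?_, ?_⟩, rfl, by ring⟩
    · rw [hg', hg]; linear_combination (N : 𝓞 K) ^ 2 * hd
    · rw [hg']; ring
    · rw [hg']; ring
  · rintro ⟨X, hX, hXe⟩
    obtain ⟨a, b, c, d, p, q, r, s, m₁, m₂, hm, hlat⟩ := (exists_latMat_iff h B _).1 ⟨X, hX, rfl⟩
    rw [hlat, FMat_mul_latMat_mul_FMat, Omega_eq_latMat_iff] at hXe
    push_cast at hXe
    obtain ⟨⟨-, h2, h3, -⟩, ⟨-, -, -, h8⟩, -, -⟩ := hXe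
    have h8' := congrArg (conjInt K) h8
    simp only [map_mul, conjInt_conjInt, map_natCast] at h8'
    -- `δδ' ≡ 1` makes `δ` invertible modulo `N`, so `N ∣ δ'γ` forces `N ∣ γ`.
    refine ⟨⟨b, by rw [h2]; ring⟩, ⟨c, by rw [h3]; ring⟩, M 1 1 * conjInt K s - M 1 0 * c, ?_⟩
    linear_combination (-M 1 0) * h3 + M 1 1 * h8'

lemma mem_gammaPrincipal_iff (B : Module.Basis (Fin 2) ℤ (𝓞 K)) {N : ℕ} (hN : 0 < N)
    (M : HilbertGroup K) : M ∈ gammaPrincipal K N ↔ ∃ X ∈ integral (Fin 4),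
      Omega (realMat K M) (realMatConj K M)
        = 1 + (N : ℝ) • (hat (GMat B) * X * (hat (GMat B))ᵀ) * splitForm := by
  obtain ⟨ω, h⟩ := exists_isGen B
  have hN0 : (N : 𝓞 K) ≠ 0 := by exact_mod_cast hN.ne'
  have hint : ∀ x : 𝓞 K, ∃ n : ℤ, x * conjInt K x = n := fun x =>
    h.exists_int_of_conj_eq (by rw [map_mul, conjInt_conjInt, mul_comm])
  have hdet : M 0 0 * M 1 1 - M 0 1 * M 1 0 = 1 := by
    rw [← Matrix.det_fin_two]; exact M.det_coe
  constructor
  · rintro ⟨ε, hε, ⟨α, hα⟩, ⟨β, hβ⟩, ⟨γ, hγ⟩, ⟨δ, hδ⟩⟩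
    obtain ⟨f, hf⟩ := hε.symm.dvd
    have hf' : (ε : 𝓞 K) ^ 2 - 1 = N * f := by
      exact_mod_cast congrArg (Int.cast : ℤ → 𝓞 K) hf
    -- With `ε² = 1 + N f`, this integer is `((ε + N x)(ε + N x') - 1) / N`, the corner entry of the
    -- lattice matrix.
    have htr : ∀ x : 𝓞 K, ∃ n : ℤ, f + ε * (x + conjInt K x) + N * (x * conjInt K x) = n :=
      fun x => h.exists_int_of_conj_eq
        (by simp only [map_add, map_mul, map_intCast, map_natCast, conjInt_conjInt]; ring)
    rw [sub_eq_iff_eq_add] at hα hδ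
    have hα' := congrArg (conjInt K) hα
    have hβ' := congrArg (conjInt K) hβ
    have hγ' := congrArg (conjInt K) hγ
    have hδ' := congrArg (conjInt K) hδ
    simp only [map_add, map_mul, map_intCast, map_natCast] at hα' hβ' hγ' hδ'
    obtain ⟨a, ha⟩ := hint β
    obtain ⟨d, hd⟩ := hint γ
    obtain ⟨b, hb⟩ := htr α
    obtain ⟨c, hc⟩ := htr δ
    have hm : ω - conjInt K ω ∣ β * conjInt K (M 1 0) -
        (f + ε * (α + conjInt K δ) + N * α * conjInt K δ) := by
      obtain ⟨x, hx⟩ := h.dvd_sub_conj δ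
      obtain ⟨y, hy⟩ := h.dvd_sub_conj γ
      refine ⟨M 0 0 * x - M 0 1 * y, mul_left_cancel₀ hN0 ?_⟩
      rw [hγ']
      rw [hα, hβ, hγ, hδ] at hdet
      rw [hα, hβ]
      linear_combination -hdet + hf' + N * (N * α + ε) * hx - N * N * β * hy
    obtain ⟨X, hX, hXe⟩ := (exists_latMat_iff h B _).2
      ⟨-N * a, b, c, -N * d, -(β * conjInt K (M 0 0)), β * conjInt K (M 1 1),
        -(M 0 0 * conjInt K γ), M 1 1 * conjInt K γ, _, _, hm, rfl⟩
    refine ⟨X, hX, ?_⟩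
    rw [← hXe, smul_latMat, Omega_eq_latMat_iff]
    push_cast
    refine ⟨⟨?_, ?_, ?_, ?_⟩, ⟨?_, ?_, ?_, ?_⟩, ?_, ?_⟩
    · rw [hβ', hβ]; linear_combination (N : 𝓞 K) ^ 2 * ha
    · rw [hα', hα]; linear_combination hf' + (N : 𝓞 K) * hb
    · rw [hδ', hδ]; linear_combination hf' + (N : 𝓞 K) * hc
    · rw [hγ', hγ]; linear_combination (N : 𝓞 K) ^ 2 * hd
    · rw [hβ]; ring
    · rw [hβ]; ring
    · rw [hγ']; ring
    · rw [hγ']; ring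
    · rw [hβ]; ring
    · rw [hδ', hα]; linear_combination hf'
  · rintro ⟨X, hX, hXe⟩
    obtain ⟨a, b, c, d, p, q, r, s, m₁, m₂, ⟨w, hw⟩, hlat⟩ :=
      (exists_latMat_iff h B _).1 ⟨X, hX, rfl⟩
    rw [hlat, smul_latMat, Omega_eq_latMat_iff] at hXe
    push_cast at hXe
    obtain ⟨⟨-, h2, h3, -⟩, ⟨h5, -, h7, -⟩, h9, h10⟩ := hXe
    have h7' := congrArg (conjInt K) h7
    simp only [map_mul, map_neg, conjInt_conjInt, map_natCast] at h7'
    obtain ⟨ε, y, hε⟩ := h.2 (M 1 1)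
    obtain ⟨ε', y', hε'⟩ := h.2 (M 1 0)
    have hεc := congrArg (conjInt K) hε
    have hεc' := congrArg (conjInt K) hε'
    simp only [map_add, map_mul, map_intCast] at hεc hεc'
    have hβ : (N : 𝓞 K) ∣ M 0 1 :=
      ⟨-(p * M 0 0) - M 0 1 * b, by linear_combination (-M 0 1) * h2 + M 0 0 * h5⟩
    have hγ : (N : 𝓞 K) ∣ M 1 0 :=
      ⟨-(M 0 0 * conjInt K r) - M 1 0 * b, by linear_combination (-M 1 0) * h2 + M 0 0 * h7'⟩
    have hαδ : (N : 𝓞 K) ∣ M 0 0 - M 1 1 :=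
      ⟨M 1 1 * m₂ - M 0 0 * c, by linear_combination (-M 0 0) * h3 + M 1 1 * h10⟩
    -- Here the congruence modulo the different is used: combined with `det M = 1` and divided by `ω
    -- - ω'`, it shows `N ∣ α y`. As `α` is a unit modulo `N`, the `ω`-coordinate `y` of `δ`
    -- vanishes modulo `N`, so `δ` is congruent to the rational integer `ε`.
    have hNw : (N : 𝓞 K) * w = M 0 0 * y - M 0 1 * y' := by
      apply mul_right_cancel₀ h.1
      have e1 : M 1 1 - conjInt K (M 1 1) = y * (ω - conjInt K ω) := by
        linear_combination hε - hεc
      have e2 : M 1 0 - conjInt K (M 1 0) = y' * (ω - conjInt K ω) := by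
        linear_combination hε' - hεc'
      linear_combination (-(N : 𝓞 K)) * hw + h10 - h9 - hdet + M 0 0 * e1 - M 0 1 * e2
    have hy : (N : 𝓞 K) ∣ y := by
      obtain ⟨β, hβ⟩ := hβ
      refine ⟨conjInt K (M 0 0) * (w + β * y') - b * y, ?_⟩
      linear_combination (-(y : 𝓞 K)) * h2 - conjInt K (M 0 0) * hNw +
        conjInt K (M 0 0) * y' * hβ
    have hδ : (N : 𝓞 K) ∣ M 1 1 - ε := by
      rw [hε, add_sub_cancel_left]
      exact hy.mul_right ω
    refine ⟨ε, ?_, ?_, hβ, hγ, hδ⟩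
    · obtain ⟨δ, hδ⟩ := hδ
      have hδ' := congrArg (conjInt K) hδ
      simp only [map_sub, map_mul, map_intCast, map_natCast] at hδ'
      rw [Int.modEq_comm, Int.modEq_iff_dvd, ← h.intCast_dvd_iff]
      push_cast
      refine ⟨c - ε * conjInt K δ - δ * conjInt K (M 1 1), ?_⟩
      linear_combination h3 - conjInt K (M 1 1) * hδ - ε * hδ'
    · have := dvd_add hαδ hδ
      rwa [sub_add_sub_cancel] at this

end Congruence

end HilbertOrth

theorem corollary2 (K : IntermediateField ℚ ℝ) [Algebra.IsQuadraticExtension ℚ K]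
    (B : Module.Basis (Fin 2) ℤ (NumberField.RingOfIntegers K)) (N : ℕ) (hN : 0 < N) :
    HilbertOrth.phi B '' (HilbertOrth.modPM K (HilbertOrth.gammaUpper K N) : Set _) =
        (fun U => HilbertOrth.FMat N * U * (HilbertOrth.FMat N)⁻¹) ''
          HilbertOrth.discKernel (HilbertOrth.hyp (HilbertOrth.gram B) N) ∧
      HilbertOrth.phi B '' (HilbertOrth.modPM K (HilbertOrth.gammaPrincipal K N) : Set _) =
        HilbertOrth.discKernel ((N : ℝ) • HilbertOrth.hyp (HilbertOrth.gram B) 1) := by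
  open HilbertOrth in
  constructor
  -- For (a) the level enters through the base change `F_N` with scale `1`; for (b) through the
  -- scale `N` with `F = 1`.
  · have key := image_eq_discKernel B (gammaUpper K N) (F := FMat N) (N := 1)
      (by simp [FMat, Matrix.det_diagonal, Fin.prod_univ_succ, hN.ne']) (FMat_mem_integral N)
      (by simp [FMat])
      (by
        ext i j
        fin_cases i <;> fin_cases j <;> simp [hat, FMat])
      one_pos
      (by simpa only [Nat.cast_one, one_smul, ← hyp_gram_eq] using hyp_gram_mem_integral B N)
      (by simpa only [Nat.cast_one, one_smul] using mem_gammaUpper_iff B hN)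
    simpa only [Nat.cast_one, one_smul, ← hyp_gram_eq] using key
  · have h1 : FMat 1 = 1 := by
      rw [FMat, Matrix.diagonal_eq_one]
      ext i
      fin_cases i <;> simp
    have hT : (hat (GMat B) * 1)ᵀ * splitForm * (hat (GMat B) * 1) = hyp (gram B) 1 := by
      rw [hyp_gram_eq, h1]
    have key := image_eq_discKernel B (gammaPrincipal K N) (F := 1) (by simp) one_mem_integral
      (by simp) (by simp) hN
      (by rw [hT]; exact natCast_smul_mem_integral N (hyp_gram_mem_integral B 1))
      (by simpa only [one_mul, mul_one] using mem_gammaPrincipal_iff B hN)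
    rw [hT] at key
    simpa using key
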